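/- **Conventions.** Fix a finite alphabet $A$. A language is a subset of $A^*$, a class is a set of languages, and $u^{-1}L=\{w\mid uw\in L\}$, $Lu^{-1}=\{w\mid wu\in L\}$. A *prevariety* is a class of regular languages that contains $\emptyset$ and $A^*$ and is closed under union, intersection, complement and the quotients $L\mapsto u^{-1}L$, $L\mapsto Lu^{-1}$ for all $u\in A^*$. A *group prevariety* is a prevariety all of whose languages are recognized by morphisms $A^*\to H$ into finite groups $H$. For a class $\mathcal{C}$, $\mathrm{SF}(\mathcal{C})$ is the least class that contains $\mathcal{C}$ and all $\{a\}$, $a\in A$, and is closed under union, complement and concatenation. An idempotent semiring $(R,+,\cdot)$ (one with $r+r=r$ for all $r$) is ordered by $r\le s\iff r+s=s$; for $S\subseteq R$ let ${\downarrow}S=\{r\mid \exists s\in S,\ r\le s\}$. A *multiplicative rating map* is a semiring morphism $\rho:(2^{A^*},\cup,\cdot)\to(R,+,\cdot)$ into a finite idempotent semiring. A map $\rho$ on $2^{A^*}$ is *nice* if every $K\subseteq A^*$ has a finite subset $F$ with $\rho(K)=\rho(F)$. We write $\rho(w)$ for $\rho(\{w\})$. Finally, $\omega\ge 1$ is an integer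 such that $r^\omega$ is idempotent for every $r\in R$. *Nested rating map.* For a class $\mathcal{D}$ and a language $L$, a $\mathcal{D}$-cover of $L$ is a finite set $\mathbf{K}\subseteq\mathcal{D}$ with $L\subseteq\bigcup_{K\in\mathbf{K}}K$. Its imprint is $\mathcal{I}[\rho](\mathbf{K})={\downarrow}\{\rho(K)\mid K\in\mathbf{K}\}\subseteq R$. If $\mathcal{D}$ contains $\emptyset$ and $A^*$ and is closed under union and intersection, the $\mathcal{D}$-covers of $L$ have a least imprint with respect to inclusion, attained by some $\mathcal{D}$-cover; it is denoted by $\mathcal{I}_{\mathcal{D}}[L,\rho]$. Let $\nu_{\mathcal{D},\rho}:2^{A^*}\to 2^R$ be the map $L\mapsto\mathcal{I}_{\mathcal{D}}[L,\rho]$. *Optimal $\varepsilon$-approximation.* Let $\mathcal{G}$ be a group prevariety and let $\tau:2^{A^*}\to Q$ be an inclusion-preserving map into a finite partially ordered set. Among the languages $L\in\mathcal{G}$ with $\varepsilon\in L$ there is one for which $\tau(L)$ is least; this least value is denoted by $\mathrm{opt}^{\varepsilon}_{\mathcal{G}}[\tau]\in Q$. The set $2^R$ is ordered by inclusion. *$\mathrm{SF}$-complete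 sets.* For $S\subseteq R$, let $\mu_{\rho,S}:2^{A^*}\to(2^R,\cup,\cdot)$ be the nice multiplicative rating map determined by $\mu_{\rho,S}(a)=\{s\,\rho(a)\,s'\mid s,s'\in S\}$ for $a\in A$, where the product on $2^R$ is $TT'=\{tt'\mid t\in T,\ t'\in T'\}$. That is, $\mu_{\rho,S}(K)=\bigcup_{a_1\cdots a_n\in K}\mu_{\rho,S}(a_1)\cdots\mu_{\rho,S}(a_n)$, with value $\{1_R\}$ on the empty product. A set $S\subseteq R$ is *$\mathrm{SF}$-complete for $\mathcal{G}$ and $\rho$* if: 1. ${\downarrow}S=S$; 2. $qr\in S$ for all $q,r\in S$; 3. $\mathrm{opt}^{\varepsilon}_{\mathcal{G}}[\mu_{\rho,S}]\subseteq S$; 4. $r^{\omega}+r^{\omega+1}\in S$ for every $r\in S$. **Theorem.** Let $\mathcal{G}$ be a group prevariety and let $\rho:2^{A^*}\to R$ be a nice multiplicative rating map. Then $\mathrm{opt}^{\varepsilon}_{\mathcal{G}}[\nu_{\mathrm{SF}(\mathcal{G}),\rho}]\subseteq R$ is the least subset of $R$ (for inclusion) that is $\mathrm{SF}$-complete for $\mathcal{G}$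 and $\rho$: it is $\mathrm{SF}$-complete, and it is contained in every $\mathrm{SF}$-complete set. -/

import Mathlib

open scoped Pointwise

namespace StarFree

/-! ### Classes of languages -/

section Classes

variable {A : Type*}

/-- The right quotient `L u⁻¹ = {w | w u ∈ L}`. -/
def rightQuotient (L : Language A) (u : List A) : Language A := {w | w ++ u ∈ L}

/-- A class of languages is a lattice when it contains the empty and the full language and is
closed under union and intersection. -/
structure IsLatticeClass (C : Set (Language A)) : Prop where
  empty_mem : (⊥ : Language A) ∈ C
  univ_mem : (⊤ : Language A) ∈ C
  union_mem : ∀ K ∈ C, ∀ L ∈ C, K ⊔ L ∈ C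
  inter_mem : ∀ K ∈ C, ∀ L ∈ C, K ⊓ L ∈ C

/-- A prevariety is a Boolean algebra of regular languages closed under quotients by words. -/
structure IsPrevariety (C : Set (Language A)) : Prop extends IsLatticeClass C where
  compl_mem : ∀ K ∈ C, Kᶜ ∈ C
  leftQuotient_mem : ∀ L ∈ C, ∀ u : List A, L.leftQuotient u ∈ C
  rightQuotient_mem : ∀ L ∈ C, ∀ u : List A, rightQuotient L u ∈ C
  regular : ∀ L ∈ C, L.IsRegular

/-- A group language is a language recognized by a morphism into a finite group. -/
def IsGroupLanguage (L : Language A) : Prop :=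
  ∃ (G : Type) (_ : Group G) (_ : Finite G) (φ : FreeMonoid A →* G) (F : Set G),
    ∀ w : List A, w ∈ L ↔ φ (FreeMonoid.ofList w) ∈ F

/-- A group prevariety is a prevariety consisting of group languages only. -/
structure IsGroupPrevariety (C : Set (Language A)) : Prop extends IsPrevariety C where
  group : ∀ L ∈ C, IsGroupLanguage L

/-- Membership in the star-free closure of `C`: the least class containing `C` and the singletons
`{a}` for the letters `a`, closed under union, complement and concatenation. -/
inductive InSF (C : Set (Language A)) : Language A → Prop
  | base {L : Language A} : L ∈ C → InSF C L
  | letter (a : A) : InSF C {[a]}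
  | union {K L : Language A} : InSF C K → InSF C L → InSF C (K ⊔ L)
  | compl {K : Language A} : InSF C K → InSF C Kᶜ
  | concat {K L : Language A} : InSF C K → InSF C L → InSF C (K * L)

/-- The star-free closure `SF(C)`. -/
def SF (C : Set (Language A)) : Set (Language A) := {L | InSF C L}

theorem SF_isLatticeClass {C : Set (Language A)} (hC : IsLatticeClass C) :
    IsLatticeClass (SF C) where
  empty_mem := .base hC.empty_mem
  univ_mem := .base hC.univ_mem
  union_mem _ hK _ hL := .union hK hL
  inter_mem K hK L hL := by
    have h : InSF C (Kᶜ ⊔ Lᶜ)ᶜ := .compl (.union (.compl hK) (.compl hL))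
    rwa [compl_sup, compl_compl, compl_compl] at h

end Classes

/-! ### Rating maps, covers and imprints

Idempotent semirings are Mathlib's `IdemSemiring`s, whose order is the canonical one:
`r ≤ s ↔ r + s = s`. The set of languages over `A`, with union and concatenation, is the semiring
`Language A`, so that a multiplicative rating map is a semiring morphism `Language A →+* R` with
`R` finite. On `Set R`, seen as a rating algebra under union, the canonical order is inclusion. -/

section Imprints

variable {A : Type*} {Q : Type*}

/-- A map on languages is nice when its value on every language `K` is already reached on a finite
subset of `K`. -/
def Nice (ρ : Language A → Q) : Prop :=
  ∀ K : Language A, ∃ F : Language A, {w | w ∈ F}.Finite ∧ F ≤ K ∧ ρ K = ρ F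

/-- The downset of a subset. -/
def downset [LE Q] (S : Set Q) : Set Q := {r | ∃ s ∈ S, r ≤ s}

/-- The `ρ`-imprint of a set of languages. -/
def imprint [LE Q] (ρ : Language A → Q) (𝒦 : Set (Language A)) : Set Q :=
  downset {q | ∃ K ∈ 𝒦, q = ρ K}

/-- `𝒦` is a `D`-cover of `L`: a finite set of languages in `D` whose union contains `L`. -/
structure IsCover (D : Set (Language A)) (L : Language A) (𝒦 : Set (Language A)) : Prop where
  finite : 𝒦.Finite
  mem_class : ∀ K ∈ 𝒦, K ∈ D
  covers : ∀ w ∈ L, ∃ K ∈ 𝒦, w ∈ K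

/-- `𝒦` is an optimal `D`-cover of `L` for `ρ`: its imprint is the least one among all
`D`-covers of `L`. -/
structure IsOptimalCover [LE Q] (D : Set (Language A)) (ρ : Language A → Q) (L : Language A)
    (𝒦 : Set (Language A)) : Prop extends IsCover D L 𝒦 where
  imprint_subset : ∀ 𝒦' : Set (Language A), IsCover D L 𝒦' → imprint ρ 𝒦 ⊆ imprint ρ 𝒦'

/-- The optimal `ρ`-imprint on `L` for `D`: the imprint of an optimal `D`-cover of `L`
(see `exists_isOptimalCover` and `optImprint_eq` for existence and uniqueness). -/
noncomputable def optImprint [LE Q] (D : Set (Language A)) (ρ : Language A → Q)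
    (L : Language A) : Set Q :=
  imprint ρ (Classical.epsilon fun 𝒦 => IsOptimalCover D ρ L 𝒦)

/-- The nested rating map associated to `D` and `ρ`, with rating algebra `(Set Q, ∪)`. -/
noncomputable def nested [LE Q] (D : Set (Language A)) (ρ : Language A → Q) :
    Language A → Set Q :=
  fun K => optImprint D ρ K

/-- `L` is an optimal `ε`-approximation in `G` for `τ`: it belongs to `G`, contains the empty word,
and has the least image under `τ` among all such languages. -/
structure IsOptimalEps [LE Q] (G : Set (Language A)) (τ : Language A → Q) (L : Language A) :
    Prop where
  mem_class : L ∈ G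
  nil_mem : [] ∈ L
  le : ∀ L' ∈ G, [] ∈ L' → τ L ≤ τ L'

/-- The image under `τ` of an optimal `ε`-approximation in `G` for `τ`
(see `exists_isOptimalEps` and `epsApprox_eq` for existence and uniqueness). -/
noncomputable def epsApprox [LE Q] (G : Set (Language A)) (τ : Language A → Q) : Q :=
  τ (Classical.epsilon fun L => IsOptimalEps G τ L)

theorem exists_isOptimalCover [Preorder Q] [Finite Q] {D : Set (Language A)}
    (hD : IsLatticeClass D) {ρ : Language A → Q} (hρ : Monotone ρ) (L : Language A) :
    ∃ 𝒦, IsOptimalCover D ρ L 𝒦 := by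
  have h0 : IsCover D L {⊤} :=
    ⟨Set.finite_singleton _, by rintro K rfl; exact hD.univ_mem,
      fun w _ => ⟨⊤, rfl, trivial⟩⟩
  obtain ⟨T, ⟨⟨𝒦, hK, hT⟩, hmin⟩⟩ :=
    (Set.toFinite {T : Set Q | ∃ 𝒦, IsCover D L 𝒦 ∧ imprint ρ 𝒦 = T}).exists_minimal
      ⟨_, _, h0, rfl⟩
  refine ⟨𝒦, hK, fun 𝒦' hK' => ?_⟩
  have hc : IsCover D L (Set.image2 (· ⊓ ·) 𝒦 𝒦') := by
    refine ⟨hK.finite.image2 _ hK'.finite, ?_, ?_⟩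
    · rintro _ ⟨K, h1, K', h2, rfl⟩
      exact hD.inter_mem _ (hK.mem_class _ h1) _ (hK'.mem_class _ h2)
    · intro w hw
      obtain ⟨K, h1, h1w⟩ := hK.covers w hw
      obtain ⟨K', h2, h2w⟩ := hK'.covers w hw
      exact ⟨_, ⟨K, h1, K', h2, rfl⟩, h1w, h2w⟩
  have hl : imprint ρ (Set.image2 (· ⊓ ·) 𝒦 𝒦') ⊆ T := by
    rw [← hT]
    rintro r ⟨_, ⟨_, ⟨K, h1, K', h2, rfl⟩, rfl⟩, hr⟩
    exact ⟨_, ⟨K, h1, rfl⟩, hr.trans (hρ inf_le_left)⟩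
  have hr : imprint ρ (Set.image2 (· ⊓ ·) 𝒦 𝒦') ⊆ imprint ρ 𝒦' := by
    rintro r ⟨_, ⟨_, ⟨K, h1, K', h2, rfl⟩, rfl⟩, hr⟩
    exact ⟨_, ⟨K', h2, rfl⟩, hr.trans (hρ inf_le_right)⟩
  rw [hT]
  exact (hmin ⟨_, hc, rfl⟩ hl).trans hr

theorem optImprint_eq [LE Q] {D : Set (Language A)} {ρ : Language A → Q} {L : Language A}
    {𝒦 : Set (Language A)} (h : IsOptimalCover D ρ L 𝒦) : optImprint D ρ L = imprint ρ 𝒦 := by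
  have h' : IsOptimalCover D ρ L (Classical.epsilon fun 𝒦 => IsOptimalCover D ρ L 𝒦) :=
    Classical.epsilon_spec (p := fun 𝒦 => IsOptimalCover D ρ L 𝒦) ⟨𝒦, h⟩
  exact (h'.imprint_subset _ h.toIsCover).antisymm (h.imprint_subset _ h'.toIsCover)

theorem nested_monotone [Preorder Q] [Finite Q] {D : Set (Language A)}
    (hD : IsLatticeClass D) {ρ : Language A → Q} (hρ : Monotone ρ) : Monotone (nested D ρ) := by
  intro H L hHL
  obtain ⟨𝒦, hK⟩ := exists_isOptimalCover hD hρ H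
  obtain ⟨𝒦', hK'⟩ := exists_isOptimalCover hD hρ L
  unfold nested
  rw [optImprint_eq hK, optImprint_eq hK']
  exact hK.imprint_subset _
    ⟨hK'.finite, hK'.mem_class, fun w hw => hK'.covers w (hHL hw)⟩

theorem exists_isOptimalEps [PartialOrder Q] [Finite Q] {G : Set (Language A)}
    (hG : IsLatticeClass G) {τ : Language A → Q} (hτ : Monotone τ) :
    ∃ L, IsOptimalEps G τ L := by
  obtain ⟨q, ⟨⟨L, hL, hn, hq⟩, hmin⟩⟩ :=
    (Set.toFinite {q : Q | ∃ L ∈ G, [] ∈ L ∧ τ L = q}).exists_minimal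
      ⟨_, ⊤, hG.univ_mem, trivial, rfl⟩
  refine ⟨L, hL, hn, fun L' hL' hn' => ?_⟩
  have h1 : τ (L ⊓ L') ≤ q := hq ▸ hτ inf_le_left
  rw [hq]
  exact (hmin ⟨_, hG.inter_mem _ hL _ hL', ⟨hn, hn'⟩, rfl⟩ h1).trans (hτ inf_le_right)

theorem epsApprox_eq [PartialOrder Q] {G : Set (Language A)} {τ : Language A → Q}
    {L : Language A} (h : IsOptimalEps G τ L) : epsApprox G τ = τ L := by
  have h' : IsOptimalEps G τ (Classical.epsilon fun L => IsOptimalEps G τ L) :=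
    Classical.epsilon_spec (p := fun L => IsOptimalEps G τ L) ⟨L, h⟩
  exact (h'.le _ h.mem_class h.nil_mem).antisymm (h.le _ h'.mem_class h'.nil_mem)

end Imprints

/-! ### The number `ω` of a finite monoid -/

section Omega

/-- The least positive integer `n` such that `s ^ n` is idempotent for every `s`. -/
noncomputable def omega (M : Type*) [Monoid M] : ℕ :=
  sInf {n : ℕ | 0 < n ∧ ∀ s : M, IsIdempotentElem (s ^ n)}

theorem omega_spec (M : Type*) [Monoid M] [Finite M] :
    0 < omega M ∧ ∀ s : M, IsIdempotentElem (s ^ omega M) := by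
  have key : ∀ s : M, ∃ n : ℕ, 0 < n ∧ IsIdempotentElem (s ^ n) := by
    intro s
    obtain ⟨i, j, hij, h⟩ := Finite.exists_ne_map_eq_of_infinite (fun n : ℕ => s ^ (n + 1))
    wlog hlt : i < j generalizing i j
    · exact this j i hij.symm h.symm (lt_of_le_of_ne (not_lt.mp hlt) hij.symm)
    obtain ⟨p, rfl⟩ := Nat.exists_eq_add_of_lt hlt
    have hstep : ∀ m, s ^ (i + 1 + m + (p + 1)) = s ^ (i + 1 + m) := by
      intro m
      have h' : s ^ (i + 1) = s ^ (i + p + 1 + 1) := h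
      rw [pow_add s (i + 1) m, h', ← pow_add]
      congr 1
      omega
    have hmul : ∀ k m, s ^ (i + 1 + m + k * (p + 1)) = s ^ (i + 1 + m) := by
      intro k
      induction k with
      | zero => simp
      | succ k ih =>
        intro m
        have e : i + 1 + m + (k + 1) * (p + 1) = i + 1 + (m + k * (p + 1)) + (p + 1) := by ring
        rw [e, hstep, ← add_assoc, ih m]
    refine ⟨(i + 1) * (p + 1), by positivity, ?_⟩
    have hm : (i + 1) * (p + 1) = i + 1 + (i + 1) * p := by ring
    unfold IsIdempotentElem
    rw [← pow_add]
    conv_rhs => rw [hm, ← hmul (i + 1)]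
    congr 1
    ring
  choose f hf hf' using key
  have := Fintype.ofFinite M
  have hne : {n : ℕ | 0 < n ∧ ∀ s : M, IsIdempotentElem (s ^ n)}.Nonempty := by
    refine ⟨∏ s, f s, Finset.prod_pos fun s _ => hf s, fun s => ?_⟩
    obtain ⟨k, hk⟩ := Finset.dvd_prod_of_mem f (Finset.mem_univ s)
    rw [hk, pow_mul]
    exact (hf' s).pow k
  exact Nat.sInf_mem hne

end Omega

/-! ### `SF`-complete sets -/

section Complete

variable {A : Type*} {R : Type*} [IdemSemiring R]

/-- The image `{s ρ(a) s' | s, s' ∈ S}` of the letter `a` under the auxiliary rating map. -/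
def muLetter (ρ : Language A → R) (S : Set R) (a : A) : Set R :=
  {r | ∃ s ∈ S, ∃ s' ∈ S, r = s * ρ {[a]} * s'}

/-- The auxiliary nice multiplicative rating map with rating algebra `(Set R, ∪, ·)`, determined by
its values `muLetter ρ S a` on the letters: a word is sent to the product of the images of its
letters, and a language to the union of the images of its words. -/
def mu (ρ : Language A → R) (S : Set R) : Language A → Set R :=
  fun K => {r | ∃ w ∈ K, r ∈ (w.map (muLetter ρ S)).prod}

theorem mu_letter (ρ : Language A → R) (S : Set R) (a : A) :
    mu ρ S {[a]} = muLetter ρ S a := by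
  ext r
  constructor
  · rintro ⟨w, rfl, h⟩
    simpa using h
  · intro h
    exact ⟨[a], rfl, by simpa using h⟩

theorem mu_zero (ρ : Language A → R) (S : Set R) : mu ρ S 0 = ∅ := by
  ext r
  exact ⟨fun ⟨w, h, _⟩ => h, fun h => h.elim⟩

theorem mu_add (ρ : Language A → R) (S : Set R) (K L : Language A) :
    mu ρ S (K + L) = mu ρ S K ∪ mu ρ S L := by
  ext r
  simp only [mu, Language.mem_add, Set.mem_union, Set.mem_ofPred_eq]
  grind

theorem mu_one (ρ : Language A → R) (S : Set R) : mu ρ S 1 = 1 := by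
  ext r
  simp [mu, Language.mem_one]

theorem mu_mul (ρ : Language A → R) (S : Set R) (K L : Language A) :
    mu ρ S (K * L) = mu ρ S K * mu ρ S L := by
  ext r
  constructor
  · rintro ⟨_, ⟨u, hu, v, hv, rfl⟩, h⟩
    simp only [List.map_append, List.prod_append] at h
    obtain ⟨x, hx, y, hy, rfl⟩ := h
    exact ⟨x, ⟨u, hu, hx⟩, y, ⟨v, hv, hy⟩, rfl⟩
  · rintro ⟨x, ⟨u, hu, hx⟩, y, ⟨v, hv, hy⟩, rfl⟩
    refine ⟨u ++ v, ⟨u, hu, v, hv, rfl⟩, ?_⟩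
    simp only [List.map_append, List.prod_append]
    exact ⟨x, hx, y, hy, rfl⟩

theorem mu_nice [Finite R] (ρ : Language A → R) (S : Set R) : Nice (mu ρ S) := by
  intro K
  choose f hf hf' using fun r : mu ρ S K => r.2
  refine ⟨(Set.range f : Set (List A)), Set.finite_range f, ?_, ?_⟩
  · rintro _ ⟨r, rfl⟩
    exact hf r
  · ext r
    constructor
    · intro h
      exact ⟨f ⟨r, h⟩, ⟨_, rfl⟩, hf' ⟨r, h⟩⟩
    · rintro ⟨_, ⟨q, rfl⟩, h⟩
      exact ⟨f q, hf q, h⟩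

/-- `S` is `SF`-complete for `G` and `ρ`. -/
structure SFComplete (G : Set (Language A)) (ρ : Language A → R) (S : Set R) : Prop where
  downset_eq : downset S = S
  mul_mem : ∀ q ∈ S, ∀ r ∈ S, q * r ∈ S
  operation : epsApprox G (mu ρ S) ⊆ S
  closure : ∀ r ∈ S, r ^ omega R + r ^ (omega R + 1) ∈ S

end Complete

end StarFree

/-!
# The least `SF`-complete set

Write `P` for the optimal `ε`-approximation of the statement and `μ` for `mu ρ S`.

`P` is `SF`-complete. Every star-free language over `G` has finitely many two-sided quotients, all
of them star-free (`SF_isQuotientAlgebra`), so the classes of the syntactic congruence of a finite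
set `𝒦` of such languages form a star-free cover refining `𝒦`. Hence `r ∈ P` means that, for all
`𝒦` and all `L ∈ G` containing `ε`, some `u ∈ L` satisfies `r ≤ ρ [u]`, where `[u]` is the
class of `u` (`mem_epsApprox_nested_iff`). Since `[u] [v] ⊆ [u v]`, this gives closure under
products and under `μ`. Closure under `r ↦ r^ω + r^(ω+1)` comes from the aperiodicity of star-free
languages relative to `G`: on a suitable `L ∈ G` containing `ε`, the classes of `u ^ l` and
`u ^ (l + 1)` coincide for `l` large (`exists_wordPow_mem_synClass`).

`P` is least. Let `S` be `SF`-complete, let `L` be optimal for `μ`, and let `H` be the syntactic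
monoid of `L`, a finite group. The pairs `(g, r)` with `r ∈ S μ(w) S` for some word `w` of class
`g` form a submonoid `T` of `H × R` whose fibre over `1` is contained in `S`, because words of
class `1` belong to `L`. It remains to cover `A*` by finitely many star-free languages `K`, each
with a `t ∈ T` having the `H`-component of all words of `K` and an `R`-component above their images.
A more general statement, for a set `X ⊆ H × R` on which `T` acts on the right, is proved by
induction on the size of `X` and on the alphabet (`exists_isDominatedCover`).
* If all letters act injectively on `X`, the words of class `g` form a single language of the cover.
  They permute `X`, so for `u = (1, r)` in the group they generate, `r^ω + r^(ω+1)` acts as `1 + r`;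
  a product of such elements dominates all words of class `1` (`exists_dominates_of_injOn`), and
  multiplying by one word of class `g` handles the words of class `g`.
* If `b` does not act injectively, words factor as `w₀ b (w₁ b) ⋯ (wₙ₋₁ b) wₙ` where the `wᵢ` avoid
  `b`. The `wᵢ` are covered by induction on the alphabet. The blocks `wᵢ b` are read as letters of a
  new finite alphabet acting on the smaller set `X b` through the submonoid `{1} ∪ T α(b)`, which
  is again `ω`-closed, and star-freeness is pulled back along this coding
  (`factorLanguage_mem_SF`).
-/

namespace StarFree

/-! ### Rating maps -/

section Rating

variable {A : Type*} {R : Type*} [IdemSemiring R]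

theorem ratingMap_monotone (ρ : Language A →+* R) : Monotone ρ := by
  intro K L h
  have h' : K + L = L := sup_eq_right.mpr h
  rw [← add_eq_right_iff_le, ← map_add, h']

theorem ratingMap_mul_le (ρ : Language A →+* R) {K L M : Language A} (h : K * L ≤ M) :
    ρ K * ρ L ≤ ρ M := by
  rw [← map_mul]
  exact ratingMap_monotone ρ h

/-- For a nice rating map, the image of a language is the least upper bound of the images of its
words. -/
theorem Nice.le_of_forall_word {ρ : Language A →+* R} (hρ : Nice ρ) {K : Language A} {t : R}
    (h : ∀ w ∈ K, ρ {w} ≤ t) : ρ K ≤ t := by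
  obtain ⟨F, hF, hFK, hK⟩ := hρ K
  rw [hK]
  have key : ∀ F : Set (List A), F.Finite → (∀ w ∈ F, ρ {w} ≤ t) → ρ (F : Language A) ≤ t := by
    intro F hF
    induction F, hF using Set.Finite.induction_on with
    | empty =>
      intro _
      have h0 : ρ (∅ : Set (List A)) = 0 := map_zero ρ
      rw [h0]
      exact zero_le
    | @insert a s _ _ ih =>
      intro hs
      have h1 : ρ (insert a s : Set (List A)) = ρ {a} + ρ (s : Set (List A)) :=
        map_add ρ {a} (show Language A from s)
      rw [h1]
      exact add_le (hs a (Set.mem_insert a s)) (ih fun w hw => hs w (Set.mem_insert_of_mem a hw))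
  exact key F hF fun w hw => h w (hFK hw)

theorem ratingMap_cons (ρ : Language A →+* R) (a : A) (w : List A) :
    ρ {a :: w} = ρ {[a]} * ρ {w} := by
  rw [← map_mul]
  congr 1
  ext v
  rw [Language.mem_mul]
  constructor
  · rintro rfl
    exact ⟨[a], rfl, w, rfl, rfl⟩
  · rintro ⟨_, rfl, _, rfl, rfl⟩
    rfl

end Rating

/-! ### Closure properties of star-free closures -/

section Closure

variable {A : Type*}

theorem sSup_mem {C : Set (Language A)} (hC : IsLatticeClass C) {𝒦 : Set (Language A)}
    (hf : 𝒦.Finite) (h : 𝒦 ⊆ C) : sSup 𝒦 ∈ C := by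
  induction 𝒦, hf using Set.Finite.induction_on with
  | empty => simpa using hC.empty_mem
  | insert _ _ ih =>
    rw [sSup_insert]
    exact hC.union_mem _ (h (Set.mem_insert _ _)) _ (ih fun x hx => h (Set.mem_insert_of_mem _ hx))

theorem sInf_mem {C : Set (Language A)} (hC : IsLatticeClass C) {𝒦 : Set (Language A)}
    (hf : 𝒦.Finite) (h : 𝒦 ⊆ C) : sInf 𝒦 ∈ C := by
  induction 𝒦, hf using Set.Finite.induction_on with
  | empty => simpa using hC.univ_mem
  | insert _ _ ih =>
    rw [sInf_insert]
    exact hC.inter_mem _ (h (Set.mem_insert _ _)) _ (ih fun x hx => h (Set.mem_insert_of_mem _ hx))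

theorem iUnion_mem {C : Set (Language A)} (hC : IsLatticeClass C) {ι : Type*} [Finite ι]
    (K : ι → Language A) (h : ∀ i, K i ∈ C) : (⨆ i, K i) ∈ C :=
  sSup_mem hC (Set.finite_range K) (by rintro _ ⟨i, rfl⟩; exact h i)

theorem mem_sSup {𝒦 : Set (Language A)} {w : List A} : w ∈ sSup 𝒦 ↔ ∃ K ∈ 𝒦, w ∈ K :=
  Set.mem_sUnion

theorem mem_sInf {𝒦 : Set (Language A)} {w : List A} : w ∈ sInf 𝒦 ↔ ∀ K ∈ 𝒦, w ∈ K :=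
  Set.mem_sInter

theorem mem_compl {K : Language A} {w : List A} : w ∈ Kᶜ ↔ w ∉ K :=
  Iff.rfl

theorem mem_sup {K L : Language A} {w : List A} : w ∈ K ⊔ L ↔ w ∈ K ∨ w ∈ L :=
  Iff.rfl

theorem mem_inf {K L : Language A} {w : List A} : w ∈ K ⊓ L ↔ w ∈ K ∧ w ∈ L :=
  Iff.rfl

/-- Atoms of the Boolean algebra generated by a finite subset of a class belong to the class. -/
theorem atom_mem {C : Set (Language A)} (hC : IsLatticeClass C) (hcompl : ∀ K ∈ C, Kᶜ ∈ C)
    {𝒦 : Set (Language A)} (hf : 𝒦.Finite) (h : 𝒦 ⊆ C) (𝒬 : Set (Language A)) :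
    ({v | ∀ K ∈ 𝒦, v ∈ K ↔ K ∈ 𝒬} : Language A) ∈ C := by
  have heq : ({v | ∀ K ∈ 𝒦, v ∈ K ↔ K ∈ 𝒬} : Language A) =
      (sInf (𝒦 ∩ 𝒬) : Language A) ⊓ (sSup (𝒦 \ 𝒬) : Language A)ᶜ := by
    ext v
    refine Iff.trans ?_ (and_congr mem_sInf (not_congr mem_sSup)).symm
    constructor
    · intro hv
      refine ⟨fun K hK => (hv K hK.1).mpr hK.2, ?_⟩
      rintro ⟨K, hK, hvK⟩
      exact hK.2 ((hv K hK.1).mp hvK)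
    · rintro ⟨h1, h2⟩ K hK
      refine ⟨fun hv => ?_, fun hQ => h1 K ⟨hK, hQ⟩⟩
      by_contra hQ
      exact h2 ⟨K, ⟨hK, hQ⟩, hv⟩
  rw [heq]
  exact hC.inter_mem _ (sInf_mem hC (hf.subset Set.inter_subset_left)
    (Set.inter_subset_left.trans h)) _ (hcompl _ (sSup_mem hC (hf.subset Set.sdiff_subset)
      (Set.sdiff_subset.trans h)))

theorem InSF.mono {C C' : Set (Language A)} (h : C ⊆ SF C') {K : Language A} (hK : InSF C K) :
    InSF C' K := by
  induction hK with
  | base h' => exact h h'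
  | letter a => exact .letter a
  | union _ _ h1 h2 => exact .union h1 h2
  | compl _ h1 => exact .compl h1
  | concat _ _ h1 h2 => exact .concat h1 h2

/-- The language of all words over the subalphabet `D`. -/
def wordsOver (D : Finset A) : Language A := {w | ∀ a ∈ w, a ∈ D}

theorem mem_wordsOver {D : Finset A} {w : List A} : w ∈ wordsOver D ↔ ∀ a ∈ w, a ∈ D :=
  Iff.rfl

theorem mem_contains {a : A} {w : List A} : w ∈ (⊤ * {[a]} * ⊤ : Language A) ↔ a ∈ w := by
  constructor
  · rintro ⟨_, ⟨u, _, _, rfl, rfl⟩, v, _, rfl⟩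
    simp
  · intro h
    obtain ⟨u, v, rfl⟩ := List.append_of_mem h
    exact ⟨u ++ [a], ⟨u, trivial, [a], rfl, rfl⟩, v, trivial, by simp⟩

theorem wordsOver_mem [Finite A] {C : Set (Language A)} (hC : IsLatticeClass C) (D : Finset A) :
    wordsOver D ∈ SF C := by
  have h : wordsOver D = (⨆ a : {a // a ∉ D}, (⊤ * {[a.1]} * ⊤ : Language A))ᶜ := by
    ext w
    rw [mem_wordsOver, mem_compl, iSup, mem_sSup]
    constructor
    · rintro h ⟨_, ⟨a, rfl⟩, ha⟩
      exact a.2 (h _ (mem_contains.mp ha))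
    · intro h a ha
      by_contra hD
      exact h ⟨_, ⟨⟨a, hD⟩, rfl⟩, mem_contains.mpr ha⟩
  rw [h]
  have h1 : InSF C ⊤ := .base hC.univ_mem
  exact .compl (iUnion_mem (SF_isLatticeClass hC) _ fun a => .concat (.concat h1 (.letter _)) h1)

end Closure

/-! ### Syntactic congruences -/

section Syntactic

variable {A : Type*}

/-- The two-sided quotient `x⁻¹ L y⁻¹`. -/
def biquotient (L : Language A) (p : List A × List A) : Language A :=
  {w | p.1 ++ (w ++ p.2) ∈ L}

theorem mem_biquotient {L : Language A} {p : List A × List A} {w : List A} :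
    w ∈ biquotient L p ↔ p.1 ++ (w ++ p.2) ∈ L :=
  Iff.rfl

/-- A Boolean algebra of languages closed under two-sided quotients by words, in which every
language has finitely many such quotients. -/
structure IsQuotientAlgebra (C : Set (Language A)) : Prop extends IsLatticeClass C where
  compl_mem : ∀ K ∈ C, Kᶜ ∈ C
  biquotient_mem : ∀ K ∈ C, ∀ p, biquotient K p ∈ C
  finite_biquotient : ∀ K ∈ C, (Set.range (biquotient K)).Finite

theorem IsGroupPrevariety.isQuotientAlgebra {G : Set (Language A)} (hG : IsGroupPrevariety G) :
    IsQuotientAlgebra G where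
  toIsLatticeClass := hG.toIsLatticeClass
  compl_mem := hG.compl_mem
  biquotient_mem K hK p := by
    have h : biquotient K p = rightQuotient (K.leftQuotient p.1) p.2 := rfl
    rw [h]
    exact hG.rightQuotient_mem _ (hG.leftQuotient_mem _ hK _) _
  finite_biquotient K hK := by
    obtain ⟨H, _, _, φ, F, hφ⟩ := hG.group K hK
    -- The quotient of `φ⁻¹(F)` by `(x, y)` only depends on `φ x` and `φ y`.
    refine (Set.finite_range fun q : H × H =>
      ({w | q.1 * (φ (FreeMonoid.ofList w) * q.2) ∈ F} : Language A)).subset ?_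
    rintro _ ⟨p, rfl⟩
    refine ⟨(φ (FreeMonoid.ofList p.1), φ (FreeMonoid.ofList p.2)), ?_⟩
    ext w
    refine Iff.trans ?_ (mem_biquotient.trans (hφ _)).symm
    rw [FreeMonoid.ofList_append, FreeMonoid.ofList_append, map_mul, map_mul]
    rfl

theorem biquotient_mul (K L : Language A) (p : List A × List A) :
    biquotient (K * L) p =
      biquotient K (p.1, []) * biquotient L ([], p.2) ⊔
        (sSup {M | ∃ x y, x ∈ K ∧ x ++ y = p.1 ∧ M = biquotient L (y, p.2)} ⊔
          sSup {M | ∃ x y, y ∈ L ∧ x ++ y = p.2 ∧ M = biquotient K (p.1, x)}) := by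
  obtain ⟨x, y⟩ := p
  ext w
  rw [mem_biquotient, mem_sup, mem_sup, mem_sSup, mem_sSup]
  constructor
  · rintro ⟨k, hk, l, hl, h⟩
    dsimp only at h
    rw [List.append_eq_append_iff] at h
    rcases h with ⟨x', h1, h2⟩ | ⟨k', h1, h2⟩
    · refine .inr (.inl ⟨_, ⟨k, x', hk, h1.symm, rfl⟩, ?_⟩)
      rw [mem_biquotient, ← h2]
      exact hl
    · rw [List.append_eq_append_iff] at h2
      rcases h2 with ⟨y', h3, h4⟩ | ⟨l', h3, h4⟩
      · refine .inr (.inr ⟨_, ⟨y', l, hl, h4.symm, rfl⟩, ?_⟩)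
        rw [mem_biquotient, ← h3, ← h1]
        exact hk
      · refine .inl ⟨k', ?_, l', ?_, h3.symm⟩
        · refine mem_biquotient.mpr ?_
          rw [List.append_nil, ← h1]
          exact hk
        · refine mem_biquotient.mpr ?_
          rw [List.nil_append, ← h4]
          exact hl
  · rintro (⟨u, hu, v, hv, rfl⟩ | ⟨_, ⟨x1, x2, h1, h2, rfl⟩, h3⟩ | ⟨_, ⟨y1, y2, h1, h2, rfl⟩, h3⟩)
    · exact ⟨_, hu, _, hv, by simp⟩
    · dsimp only at h2 ⊢
      subst h2
      exact ⟨x1, h1, _, h3, by simp⟩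
    · dsimp only at h2 ⊢
      subst h2
      exact ⟨_, h3, y2, h1, by simp⟩

theorem biquotient_letter (a : A) (p : List A × List A) :
    biquotient {[a]} p ∈ ({⊥, wordsOver ∅, {[a]}} : Set (Language A)) := by
  obtain ⟨x, y⟩ := p
  by_cases h : x ++ y = []
  · obtain ⟨rfl, rfl⟩ := List.append_eq_nil_iff.mp h
    right; right
    ext w
    rw [mem_biquotient, List.append_nil, List.nil_append]
  · have hnil : ∀ w, w ∈ biquotient {[a]} (x, y) → w = [] := by
      intro w hw
      have h1 : x ++ (w ++ y) = [a] := hw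
      have h2 := congrArg List.length h1
      have h3 := List.length_pos_iff.mpr h
      simp only [List.length_append, List.length_singleton] at h2 h3
      exact List.length_eq_zero_iff.mp (by omega)
    by_cases h' : [] ∈ biquotient {[a]} (x, y)
    · right; left
      ext w
      constructor
      · intro hw
        rw [hnil w hw, mem_wordsOver]
        simp
      · intro hw
        rw [mem_wordsOver] at hw
        rwa [List.eq_nil_iff_forall_not_mem.mpr fun b hb => Finset.notMem_empty _ (hw b hb)]
    · left
      ext w
      refine ⟨fun hw => h' ?_, fun hw => hw.elim⟩
      rwa [hnil w hw] at hw

/-- A quotient of `K L` by `(x, y)` is the union of a product of quotients of `K` and `L`, of quotients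
of `L` and of quotients of `K` (`biquotient_mul`), so finiteness passes to concatenations. -/
theorem SF_isQuotientAlgebra [Finite A] {C : Set (Language A)} (hC : IsQuotientAlgebra C) :
    IsQuotientAlgebra (SF C) := by
  have hSF := SF_isLatticeClass hC.toIsLatticeClass
  have key : ∀ K ∈ SF C, (∀ p, biquotient K p ∈ SF C) ∧ (Set.range (biquotient K)).Finite := by
    intro K hK
    induction hK with
    | base h =>
      exact ⟨fun p => .base (hC.biquotient_mem _ h p), hC.finite_biquotient _ h⟩
    | letter a =>
      refine ⟨fun p => ?_, (Set.toFinite ({⊥, wordsOver ∅, {[a]}} : Set (Language A))).subset ?_⟩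
      · rcases biquotient_letter a p with h | h | h
        · rw [h]
          exact hSF.empty_mem
        · rw [h]
          exact wordsOver_mem hC.toIsLatticeClass _
        · rw [Set.mem_singleton_iff.mp h]
          exact .letter a
      · rintro _ ⟨p, rfl⟩
        exact biquotient_letter a p
    | union _ _ h1 h2 =>
      refine ⟨fun p => .union (h1.1 p) (h2.1 p), (h1.2.image2 (· ⊔ ·) h2.2).subset ?_⟩
      rintro _ ⟨p, rfl⟩
      exact ⟨_, ⟨p, rfl⟩, _, ⟨p, rfl⟩, rfl⟩
    | compl _ h =>
      refine ⟨fun p => .compl (h.1 p), (h.2.image (·ᶜ)).subset ?_⟩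
      rintro _ ⟨p, rfl⟩
      exact ⟨_, ⟨p, rfl⟩, rfl⟩
    | @concat K L _ _ h1 h2 =>
      have hL : ∀ p : List A × List A,
          {M | ∃ x y, x ∈ K ∧ x ++ y = p.1 ∧ M = biquotient L (y, p.2)} ⊆
            Set.range (biquotient L) := by
        rintro p _ ⟨x, y, -, -, rfl⟩
        exact ⟨_, rfl⟩
      have hK : ∀ p : List A × List A,
          {M | ∃ x y, y ∈ L ∧ x ++ y = p.2 ∧ M = biquotient K (p.1, x)} ⊆
            Set.range (biquotient K) := by
        rintro p _ ⟨x, y, -, -, rfl⟩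
        exact ⟨_, rfl⟩
      constructor
      · intro p
        rw [biquotient_mul]
        refine .union (.concat (h1.1 _) (h2.1 _)) (.union ?_ ?_)
        · refine sSup_mem hSF (h2.2.subset (hL p)) ((hL p).trans ?_)
          rintro _ ⟨q, rfl⟩
          exact h2.1 q
        · refine sSup_mem hSF (h1.2.subset (hK p)) ((hK p).trans ?_)
          rintro _ ⟨q, rfl⟩
          exact h1.1 q
      · refine ((h1.2.image2 (· * ·) h2.2).image2 (· ⊔ ·)
          ((h2.2.finite_subsets.image sSup).image2 (· ⊔ ·)
            (h1.2.finite_subsets.image sSup))).subset ?_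
        rintro _ ⟨p, rfl⟩
        rw [biquotient_mul]
        exact ⟨_, ⟨_, ⟨_, rfl⟩, _, ⟨_, rfl⟩, rfl⟩, _,
          ⟨_, ⟨_, hL p, rfl⟩, _, ⟨_, hK p, rfl⟩, rfl⟩, rfl⟩
  exact
    { toIsLatticeClass := hSF
      compl_mem := fun K hK => .compl hK
      biquotient_mem := fun K hK => (key K hK).1
      finite_biquotient := fun K hK => (key K hK).2 }

/-- The syntactic congruence of a set of languages: two words are equivalent when no language of
the set separates them in any context. -/
def synCon (𝒦 : Set (Language A)) : Con (FreeMonoid A) where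
  r u v := ∀ K ∈ 𝒦, ∀ p, u.toList ∈ biquotient K p ↔ v.toList ∈ biquotient K p
  iseqv :=
    { refl := fun _ _ _ _ => Iff.rfl
      symm := fun h K hK p => (h K hK p).symm
      trans := fun h h' K hK p => (h K hK p).trans (h' K hK p) }
  mul' := by
    intro u u' v v' h h' K hK p
    have h1 := h K hK (p.1, v.toList ++ p.2)
    have h2 := h' K hK (p.1 ++ u'.toList, p.2)
    simp only [mem_biquotient, FreeMonoid.toList_mul, List.append_assoc] at h1 h2 ⊢
    exact h1.trans h2

/-- The class of the word `u` for the syntactic congruence of `𝒦`, as a language. -/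
def synClass (𝒦 : Set (Language A)) (u : List A) : Language A :=
  {v | synCon 𝒦 (FreeMonoid.ofList v) (FreeMonoid.ofList u)}

theorem mem_synClass {𝒦 : Set (Language A)} {u v : List A} :
    v ∈ synClass 𝒦 u ↔ synCon 𝒦 (FreeMonoid.ofList v) (FreeMonoid.ofList u) :=
  Iff.rfl

theorem mem_synClass_iff {𝒦 : Set (Language A)} {u v : List A} :
    v ∈ synClass 𝒦 u ↔ ∀ K ∈ 𝒦, ∀ p, v ∈ biquotient K p ↔ u ∈ biquotient K p :=
  Iff.rfl

theorem mem_synClass_self (𝒦 : Set (Language A)) (u : List A) : u ∈ synClass 𝒦 u :=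
  mem_synClass.mpr ((synCon 𝒦).refl _)

theorem synClass_eq {𝒦 : Set (Language A)} {u v : List A} (h : v ∈ synClass 𝒦 u) :
    synClass 𝒦 v = synClass 𝒦 u := by
  ext w
  exact ⟨fun hw => (synCon 𝒦).trans hw h, fun hw => (synCon 𝒦).trans hw ((synCon 𝒦).symm h)⟩

theorem append_mem_synClass {𝒦 : Set (Language A)} {u u' v v' : List A} (h : u ∈ synClass 𝒦 u')
    (h' : v ∈ synClass 𝒦 v') : u ++ v ∈ synClass 𝒦 (u' ++ v') :=
  (synCon 𝒦).mul h h'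

theorem synClass_mul_le (𝒦 : Set (Language A)) (u v : List A) :
    synClass 𝒦 u * synClass 𝒦 v ≤ synClass 𝒦 (u ++ v) := by
  rintro _ ⟨u', hu, v', hv, rfl⟩
  exact append_mem_synClass hu hv

theorem mem_iff_of_mem_synClass {𝒦 : Set (Language A)} {u v : List A} (h : v ∈ synClass 𝒦 u)
    {K : Language A} (hK : K ∈ 𝒦) : v ∈ K ↔ u ∈ K := by
  have := mem_synClass_iff.mp h K hK ([], [])
  simpa only [mem_biquotient, List.nil_append, List.append_nil] using this

theorem synClass_le {𝒦 : Set (Language A)} {u : List A} {K : Language A} (hK : K ∈ 𝒦)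
    (hu : u ∈ K) : synClass 𝒦 u ≤ K :=
  fun _ hv => (mem_iff_of_mem_synClass hv hK).mpr hu

theorem finite_biquotients {C : Set (Language A)} (hC : IsQuotientAlgebra C)
    {𝒦 : Set (Language A)} (hf : 𝒦.Finite) (h : 𝒦 ⊆ C) :
    {M | ∃ K ∈ 𝒦, ∃ p, M = biquotient K p}.Finite := by
  refine (hf.biUnion fun K hK => hC.finite_biquotient K (h hK)).subset ?_
  rintro _ ⟨K, hK, p, rfl⟩
  exact Set.mem_biUnion hK ⟨p, rfl⟩

/-- A class of the syntactic congruence is a finite Boolean combination of two-sided quotients. -/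
theorem synClass_mem {C : Set (Language A)} (hC : IsQuotientAlgebra C) {𝒦 : Set (Language A)}
    (hf : 𝒦.Finite) (h : 𝒦 ⊆ C) (u : List A) : synClass 𝒦 u ∈ C := by
  have hfin := finite_biquotients hC hf h
  have hsub : {M | ∃ K ∈ 𝒦, ∃ p, M = biquotient K p} ⊆ C := by
    rintro _ ⟨K, hK, p, rfl⟩
    exact hC.biquotient_mem K (h hK) p
  have heq : synClass 𝒦 u = ({v | ∀ M ∈ {M | ∃ K ∈ 𝒦, ∃ p, M = biquotient K p},
      v ∈ M ↔ M ∈ {M : Language A | u ∈ M}} : Language A) := by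
    ext v
    refine mem_synClass_iff.trans ⟨?_, fun hv K hK p => hv _ ⟨K, hK, p, rfl⟩⟩
    rintro hv _ ⟨K, hK, p, rfl⟩
    exact hv K hK p
  rw [heq]
  exact atom_mem hC.toIsLatticeClass hC.compl_mem hfin hsub _

theorem finite_range_synClass {C : Set (Language A)} (hC : IsQuotientAlgebra C)
    {𝒦 : Set (Language A)} (hf : 𝒦.Finite) (h : 𝒦 ⊆ C) : (Set.range (synClass 𝒦)).Finite := by
  have hfin := finite_biquotients hC hf h
  -- The class of `u` is determined by the set of two-sided quotients containing `u`.
  refine (hfin.finite_subsets.image fun 𝒬 => ({v | ∀ K ∈ 𝒦, ∀ p, v ∈ biquotient K p ↔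
    biquotient K p ∈ 𝒬} : Language A)).subset ?_
  rintro _ ⟨u, rfl⟩
  refine ⟨{M | (∃ K ∈ 𝒦, ∃ p, M = biquotient K p) ∧ u ∈ M}, fun M hM => hM.1, ?_⟩
  ext v
  refine forall₂_congr fun K hK => forall_congr' fun p => ?_
  exact iff_congr Iff.rfl ⟨fun hu => hu.2, fun hu => ⟨⟨K, hK, p, rfl⟩, hu⟩⟩

end Syntactic

/-! ### Optimal imprints through syntactic classes -/

section Imprint

variable {A : Type*} {R : Type*}

theorem mem_optImprint_iff [Preorder R] [Finite R] {D : Set (Language A)} (hD : IsLatticeClass D)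
    {ρ : Language A → R} (hρ : Monotone ρ) {L : Language A} {r : R} :
    r ∈ optImprint D ρ L ↔ ∀ 𝒦, IsCover D L 𝒦 → ∃ K ∈ 𝒦, r ≤ ρ K := by
  obtain ⟨𝒦, h⟩ := exists_isOptimalCover hD hρ L
  have himp : ∀ 𝒦 : Set (Language A), r ∈ imprint ρ 𝒦 ↔ ∃ K ∈ 𝒦, r ≤ ρ K := by
    intro 𝒦
    constructor
    · rintro ⟨_, ⟨K, hK, rfl⟩, hr⟩
      exact ⟨K, hK, hr⟩
    · rintro ⟨K, hK, hr⟩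
      exact ⟨_, ⟨K, hK, rfl⟩, hr⟩
  rw [optImprint_eq h]
  exact ⟨fun hr 𝒦' h' => (himp _).mp (h.imprint_subset _ h' hr),
    fun hr => (himp _).mpr (hr _ h.toIsCover)⟩

theorem mem_epsApprox_iff [Finite R] {G : Set (Language A)} (hG : IsLatticeClass G)
    {τ : Language A → Set R} (hτ : Monotone τ) {r : R} :
    r ∈ epsApprox G τ ↔ ∀ L ∈ G, [] ∈ L → r ∈ τ L := by
  obtain ⟨L, h⟩ := exists_isOptimalEps hG hτ
  rw [epsApprox_eq h]
  exact ⟨fun hr L' h1 h2 => h.le L' h1 h2 hr, fun hr => hr L h.mem_class h.nil_mem⟩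

/-- Syntactic classes of finite sets of star-free languages suffice to compute the optimal
`ε`-approximation: they refine every cover. -/
theorem mem_epsApprox_nested_iff [Finite A] [IdemSemiring R] [Finite R] {G : Set (Language A)}
    (hG : IsQuotientAlgebra G) (ρ : Language A →+* R) {r : R} :
    r ∈ epsApprox G (nested (SF G) ρ) ↔ ∀ L ∈ G, [] ∈ L → ∀ 𝒦 : Set (Language A), 𝒦.Finite →
      𝒦 ⊆ SF G → ∃ u ∈ L, r ≤ ρ (synClass 𝒦 u) := by
  have hSF := SF_isQuotientAlgebra hG
  have hm := ratingMap_monotone ρ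
  rw [mem_epsApprox_iff hG.toIsLatticeClass (nested_monotone hSF.toIsLatticeClass hm)]
  refine forall₃_congr fun L hL hn => ?_
  refine (mem_optImprint_iff hSF.toIsLatticeClass hm).trans ?_
  constructor
  · intro h 𝒦 hf h𝒦
    have hc : IsCover (SF G) L {K | ∃ u ∈ L, K = synClass 𝒦 u} := by
      refine ⟨(finite_range_synClass hSF hf h𝒦).subset ?_, ?_, ?_⟩
      · rintro _ ⟨u, -, rfl⟩
        exact ⟨u, rfl⟩
      · rintro _ ⟨u, -, rfl⟩
        exact synClass_mem hSF hf h𝒦 u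
      · exact fun u hu => ⟨_, ⟨u, hu, rfl⟩, mem_synClass_self 𝒦 u⟩
    obtain ⟨_, ⟨u, hu, rfl⟩, hr⟩ := h _ hc
    exact ⟨u, hu, hr⟩
  · intro h 𝒦 hc
    obtain ⟨u, hu, hr⟩ := h 𝒦 hc.finite hc.mem_class
    obtain ⟨K, hK, huK⟩ := hc.covers u hu
    exact ⟨K, hK, hr.trans (hm (synClass_le hK huK))⟩

end Imprint

/-! ### Powers of words in star-free languages -/

section Powers

variable {A : Type*}

/-- The word `u` repeated `n` times. -/
def wordPow (u : List A) (n : ℕ) : List A := (List.replicate n u).flatten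

theorem wordPow_zero (u : List A) : wordPow u 0 = [] := rfl

theorem wordPow_succ (u : List A) (n : ℕ) : wordPow u (n + 1) = u ++ wordPow u n := by
  simp [wordPow, List.replicate_succ]

theorem wordPow_succ' (u : List A) (n : ℕ) : wordPow u (n + 1) = wordPow u n ++ u := by
  induction n with
  | zero => simp [wordPow]
  | succ n ih => rw [wordPow_succ, ih, ← List.append_assoc, ← wordPow_succ, ih]

theorem length_wordPow (u : List A) (n : ℕ) : (wordPow u n).length = n * u.length := by
  simp [wordPow]

/-- A factorization of `u ^ (n + 1)` in two words cuts one of the copies of `u`. -/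
theorem wordPow_eq_append {u m₁ m₂ : List A} {n : ℕ} (h : wordPow u (n + 1) = m₁ ++ m₂) :
    ∃ i j v v', i + j = n ∧ m₁ = wordPow u i ++ v ∧ m₂ = v' ++ wordPow u j ∧ v ++ v' = u := by
  induction n generalizing m₁ with
  | zero =>
    refine ⟨0, 0, m₁, m₂, rfl, rfl, (List.append_nil _).symm, ?_⟩
    rw [← h, wordPow_succ, wordPow_zero, List.append_nil]
  | succ n ih =>
    rw [wordPow_succ, List.append_eq_append_iff] at h
    rcases h with ⟨m, h1, h2⟩ | ⟨v', h1, h2⟩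
    · obtain ⟨i, j, v, v', hij, hm, hm2, hu⟩ := ih h2
      refine ⟨i + 1, j, v, v', by omega, ?_, hm2, hu⟩
      rw [h1, hm, wordPow_succ, List.append_assoc]
    · exact ⟨0, n + 1, m₁, v', by omega, rfl, h2, h1.symm⟩

theorem wordPow_append_mem_iff {K : Language A} {u : List A} {i : ℕ}
    (h : ∀ p, wordPow u i ∈ biquotient K p ↔ wordPow u (i + 1) ∈ biquotient K p)
    (x y v : List A) :
    wordPow u i ++ v ∈ biquotient K (x, y) ↔ wordPow u (i + 1) ++ v ∈ biquotient K (x, y) := by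
  have := h (x, v ++ y)
  simpa only [mem_biquotient, List.append_assoc] using this

theorem append_wordPow_mem_iff {K : Language A} {u : List A} {i : ℕ}
    (h : ∀ p, wordPow u i ∈ biquotient K p ↔ wordPow u (i + 1) ∈ biquotient K p)
    (x y v : List A) :
    v ++ wordPow u i ∈ biquotient K (x, y) ↔ v ++ wordPow u (i + 1) ∈ biquotient K (x, y) := by
  have := h (x ++ v, y)
  simpa only [mem_biquotient, List.append_assoc] using this

/-- Star-free languages over `G` are aperiodic up to `G`: they do not count the powers of the
words of a suitable neighbourhood of `ε` in `G`. -/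
theorem InSF.exists_wordPow_mem_iff {G : Set (Language A)} (hG : IsQuotientAlgebra G)
    {K : Language A} (hK : InSF G K) :
    ∃ L ∈ G, [] ∈ L ∧ ∃ k, ∀ u ∈ L, ∀ l ≥ k, ∀ p,
      wordPow u l ∈ biquotient K p ↔ wordPow u (l + 1) ∈ biquotient K p := by
  induction hK with
  | @base K h =>
    have hs : ({K} : Set (Language A)) ⊆ G := Set.singleton_subset_iff.mpr h
    refine ⟨synClass {K} [], synClass_mem hG (Set.finite_singleton K) hs _,
      mem_synClass_self _ _, 0, fun u hu l _ p => ?_⟩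
    have h1 := append_mem_synClass hu (mem_synClass_self {K} (wordPow u l))
    rw [← wordPow_succ] at h1
    exact (mem_synClass_iff.mp h1 K rfl p).symm
  | letter a =>
    refine ⟨⊤, hG.univ_mem, trivial, 2, fun u _ l hl p => ?_⟩
    by_cases hu : u = []
    · simp [hu, wordPow]
    · have hlen : ∀ n ≥ 2, wordPow u n ∉ biquotient {[a]} p := by
        intro n hn hmem
        have h1 : p.1 ++ (wordPow u n ++ p.2) = [a] := hmem
        have h2 := congrArg List.length h1
        have h3 := Nat.mul_le_mul hn (List.length_pos_iff.mpr hu)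
        simp only [List.length_append, List.length_singleton, length_wordPow] at h2
        omega
      exact iff_of_false (hlen l hl) (hlen (l + 1) (by omega))
  | union _ _ h1 h2 =>
    obtain ⟨L1, hL1, hn1, k1, h1⟩ := h1
    obtain ⟨L2, hL2, hn2, k2, h2⟩ := h2
    refine ⟨L1 ⊓ L2, hG.inter_mem _ hL1 _ hL2, ⟨hn1, hn2⟩, max k1 k2, fun u hu l hl p => ?_⟩
    exact or_congr (h1 u hu.1 l (le_of_max_le_left hl) p) (h2 u hu.2 l (le_of_max_le_right hl) p)
  | compl _ h =>
    obtain ⟨L, hL, hn, k, h⟩ := h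
    exact ⟨L, hL, hn, k, fun u hu l hl p => not_congr (h u hu l hl p)⟩
  | @concat K L _ _ h1 h2 =>
    obtain ⟨L1, hL1, hn1, k1, h1⟩ := h1
    obtain ⟨L2, hL2, hn2, k2, h2⟩ := h2
    refine ⟨L1 ⊓ L2, hG.inter_mem _ hL1 _ hL2, ⟨hn1, hn2⟩, k1 + k2 + 1, fun u hu l hl p => ?_⟩
    rw [biquotient_mul, mem_sup, mem_sup, mem_sup, mem_sup, mem_sSup, mem_sSup, mem_sSup, mem_sSup]
    refine or_congr ?_ (or_congr ?_ ?_)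
    · -- One of the two factors of a power of `u` contains a large power of `u`.
      constructor
      · rintro ⟨m1, hm1, m2, hm2, hm⟩
        obtain ⟨n, rfl⟩ := Nat.exists_eq_add_of_lt (Nat.zero_lt_of_lt hl)
        rw [zero_add] at hl hm ⊢
        obtain ⟨i, j, v, v', rfl, rfl, rfl, hv⟩ := wordPow_eq_append hm.symm
        by_cases hi : k1 ≤ i
        · refine ⟨_, (wordPow_append_mem_iff (h1 u hu.1 i hi) _ _ v).mp hm1, _, hm2, ?_⟩
          dsimp only at hm ⊢
          rw [wordPow_succ u i, List.append_assoc u, List.append_assoc u, hm, ← wordPow_succ]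
        · refine ⟨_, hm1, _, (append_wordPow_mem_iff (h2 u hu.2 j (by omega)) _ _ v').mp hm2, ?_⟩
          dsimp only at hm ⊢
          rw [wordPow_succ', ← List.append_assoc, ← List.append_assoc, List.append_assoc _ v', hm,
            ← wordPow_succ']
      · rintro ⟨m1, hm1, m2, hm2, hm⟩
        obtain ⟨i, j, v, v', rfl, rfl, rfl, hv⟩ := wordPow_eq_append hm.symm
        by_cases hi : k1 + 1 ≤ i
        · obtain ⟨i, rfl⟩ := Nat.exists_eq_add_of_lt (Nat.zero_lt_of_lt hi)
          rw [zero_add] at *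
          refine ⟨_, (wordPow_append_mem_iff (h1 u hu.1 i (by omega)) _ _ v).mpr hm1, _, hm2, ?_⟩
          dsimp only at hm ⊢
          rw [wordPow_succ u (i + 1 + j), wordPow_succ u i, List.append_assoc,
            List.append_assoc] at hm
          rw [List.append_assoc]
          exact List.append_cancel_left hm
        · obtain ⟨j, rfl⟩ := Nat.exists_eq_add_of_lt (show 0 < j by omega)
          rw [zero_add] at *
          refine ⟨_, hm1, _,
            (append_wordPow_mem_iff (h2 u hu.2 j (by omega)) _ _ v').mpr hm2, ?_⟩
          dsimp only at hm ⊢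
          rw [wordPow_succ' u (i + (j + 1)), wordPow_succ' u j, ← List.append_assoc v',
            ← List.append_assoc] at hm
          exact List.append_cancel_right hm
    · refine exists_congr fun M => and_congr_right ?_
      rintro ⟨x, y, -, -, rfl⟩
      exact h2 u hu.2 l (by omega) _
    · refine exists_congr fun M => and_congr_right ?_
      rintro ⟨x, y, -, -, rfl⟩
      exact h1 u hu.1 l (by omega) _

theorem exists_wordPow_mem_synClass {G : Set (Language A)} (hG : IsQuotientAlgebra G)
    {𝒦 : Set (Language A)} (hf : 𝒦.Finite) (h𝒦 : 𝒦 ⊆ SF G) :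
    ∃ L ∈ G, [] ∈ L ∧ ∃ k, ∀ u ∈ L, ∀ l ≥ k, wordPow u (l + 1) ∈ synClass 𝒦 (wordPow u l) := by
  induction 𝒦, hf using Set.Finite.induction_on with
  | empty => exact ⟨⊤, hG.univ_mem, trivial, 0, fun u _ l _ K hK => hK.elim⟩
  | insert _ _ ih =>
    obtain ⟨L1, hL1, hn1, k1, h1⟩ := ih fun K hK => h𝒦 (Set.mem_insert_of_mem _ hK)
    obtain ⟨L2, hL2, hn2, k2, h2⟩ :=
      InSF.exists_wordPow_mem_iff hG (h𝒦 (Set.mem_insert _ _))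
    refine ⟨L1 ⊓ L2, hG.inter_mem _ hL1 _ hL2, ⟨hn1, hn2⟩, max k1 k2, fun u hu l hl => ?_⟩
    rw [mem_synClass_iff]
    rintro K (rfl | hK) p
    · exact (h2 u hu.2 l (le_of_max_le_right hl) p).symm
    · exact mem_synClass_iff.mp (h1 u hu.1 l (le_of_max_le_left hl)) K hK p

end Powers

/-! ### The optimal approximation is `SF`-complete -/

section Soundness

variable {A : Type*} {R : Type*} [IdemSemiring R]

theorem mu_monotone (ρ : Language A → R) (S : Set R) : Monotone (mu ρ S) := by
  rintro K L h r ⟨w, hw, hr⟩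
  exact ⟨w, h hw, hr⟩

theorem pow_le_ratingMap_synClass (ρ : Language A →+* R) {𝒦 : Set (Language A)} {u : List A}
    {r : R} (hr : r ≤ ρ (synClass 𝒦 u)) (n : ℕ) :
    r ^ n ≤ ρ (synClass 𝒦 (wordPow u n)) := by
  induction n with
  | zero =>
    rw [pow_zero, ← map_one ρ]
    refine ratingMap_monotone ρ ?_
    rintro _ rfl
    exact mem_synClass_self _ _
  | succ n ih =>
    rw [pow_succ', wordPow_succ]
    exact (mul_le_mul' hr ih).trans (ratingMap_mul_le ρ (synClass_mul_le _ _ _))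

theorem wordPow_mem_synClass_nil {𝒦 : Set (Language A)} {u : List A} (hu : u ∈ synClass 𝒦 [])
    (n : ℕ) : wordPow u n ∈ synClass 𝒦 [] := by
  induction n with
  | zero => exact mem_synClass_self _ _
  | succ n ih =>
    rw [wordPow_succ]
    exact append_mem_synClass hu ih

variable [Finite A] [Finite R]

theorem epsApprox_nested_sfComplete {G : Set (Language A)} (hG : IsGroupPrevariety G)
    (ρ : Language A →+* R) : SFComplete G ρ (epsApprox G (nested (SF G) ρ)) := by
  have hQ := hG.isQuotientAlgebra
  have hker : ∀ L ∈ G, synClass {L} [] ∈ G := fun L hL =>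
    synClass_mem hQ (Set.finite_singleton L) (Set.singleton_subset_iff.mpr hL) _
  have hmem := fun r : R => mem_epsApprox_nested_iff (r := r) hQ ρ
  constructor
  · refine Set.Subset.antisymm ?_ fun r hr => ⟨r, hr, le_rfl⟩
    rintro r ⟨s, hs, hrs⟩
    rw [hmem] at hs ⊢
    intro L hL hn 𝒦 hf h𝒦
    obtain ⟨u, hu, h⟩ := hs L hL hn 𝒦 hf h𝒦
    exact ⟨u, hu, hrs.trans h⟩
  · intro q hq r hr
    rw [hmem] at hq hr ⊢
    intro L hL hn 𝒦 hf h𝒦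
    obtain ⟨u, hu, h⟩ := hq _ (hker L hL) (mem_synClass_self _ _) 𝒦 hf h𝒦
    obtain ⟨v, hv, h'⟩ := hr _ (hker L hL) (mem_synClass_self _ _) 𝒦 hf h𝒦
    exact ⟨u ++ v, (mem_iff_of_mem_synClass (append_mem_synClass hu hv) rfl).mpr hn,
      (mul_le_mul' h h').trans (ratingMap_mul_le ρ (synClass_mul_le _ _ _))⟩
  · intro r hr
    rw [hmem]
    intro L hL hn 𝒦 hf h𝒦
    have hr' := (mem_epsApprox_iff hQ.toIsLatticeClass (mu_monotone _ _)).mp hr _ (hker L hL)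
      (mem_synClass_self _ _)
    obtain ⟨w, hw, hr'⟩ := hr'
    have key : ∀ w : List A, ∀ r ∈ (w.map (muLetter ρ (epsApprox G (nested (SF G) ρ)))).prod,
        ∃ v ∈ synClass {L} w, r ≤ ρ (synClass 𝒦 v) := by
      intro w
      induction w with
      | nil =>
        rintro r hr
        rw [List.map_nil, List.prod_nil, Set.mem_one] at hr
        refine ⟨[], mem_synClass_self _ _, ?_⟩
        rw [hr]
        exact (pow_zero _).symm.le.trans (pow_le_ratingMap_synClass ρ (u := []) le_rfl 0)
      | cons a w ih =>
        rintro r hr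
        rw [List.map_cons, List.prod_cons] at hr
        obtain ⟨_, ⟨s, hs, s', hs', rfl⟩, t, ht, rfl⟩ := hr
        obtain ⟨u, hu, h⟩ := (hmem s).mp hs _ (hker L hL) (mem_synClass_self _ _) 𝒦 hf h𝒦
        obtain ⟨u', hu', h'⟩ := (hmem s').mp hs' _ (hker L hL) (mem_synClass_self _ _) 𝒦 hf h𝒦
        obtain ⟨v, hv, hv'⟩ := ih t ht
        have ha : ρ {[a]} ≤ ρ (synClass 𝒦 [a]) := by
          refine ratingMap_monotone ρ ?_
          rintro _ rfl
          exact mem_synClass_self _ _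
        refine ⟨u ++ [a] ++ u' ++ v, ?_, ?_⟩
        · exact append_mem_synClass (append_mem_synClass (append_mem_synClass hu
            (mem_synClass_self _ [a])) hu') hv
        · refine (mul_le_mul' (mul_le_mul' (mul_le_mul' h ha) h') hv').trans ?_
          rw [← map_mul, ← map_mul, ← map_mul]
          refine ratingMap_monotone ρ ?_
          rintro _ ⟨_, ⟨_, ⟨x, hx, y, hy, rfl⟩, z, hz, rfl⟩, t, ht, rfl⟩
          exact append_mem_synClass (append_mem_synClass (append_mem_synClass hx hy) hz) ht
    obtain ⟨v, hv, h⟩ := key w r hr'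
    refine ⟨v, ?_, h⟩
    rw [synClass_eq hw] at hv
    exact (mem_iff_of_mem_synClass hv rfl).mpr hn
  · intro r hr
    rw [hmem] at hr ⊢
    intro L hL hn 𝒦 hf h𝒦
    obtain ⟨L', hL', hn', k, hk⟩ := exists_wordPow_mem_synClass hQ hf h𝒦
    obtain ⟨u, ⟨hu, hu'⟩, h⟩ := hr (synClass {L} [] ⊓ L') (hG.inter_mem _ (hker L hL) _ hL')
      ⟨mem_synClass_self _ _, hn'⟩ 𝒦 hf h𝒦
    obtain ⟨hω, hidem⟩ := omega_spec R
    have hpow : r ^ (omega R * (k + 1)) = r ^ omega R := by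
      rw [pow_mul, (hidem r).pow_succ_eq]
    have hle : k ≤ omega R * (k + 1) := by nlinarith
    refine ⟨_, (mem_iff_of_mem_synClass (wordPow_mem_synClass_nil hu (omega R * (k + 1)))
      rfl).mpr hn, add_le ?_ ?_⟩
    · rw [← hpow]
      exact pow_le_ratingMap_synClass ρ h _
    · rw [pow_succ, ← hpow, ← pow_succ, ← synClass_eq (hk u hu' _ hle)]
      exact pow_le_ratingMap_synClass ρ h _

end Soundness

/-! ### Actions of submonoids of `H × R` -/

section Domination

variable {H : Type*} {R : Type*} [IdemSemiring R]

/-- `t` dominates `m` on `X`: both have the same `H`-component, and acting by `t` on the right of an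
element of `X` gives a larger `R`-component than acting by `m`. -/
def Dominates (X : Set (H × R)) (m t : H × R) : Prop :=
  m.1 = t.1 ∧ ∀ x ∈ X, x.2 * m.2 ≤ x.2 * t.2

theorem Dominates.refl (X : Set (H × R)) (m : H × R) : Dominates X m m :=
  ⟨rfl, fun _ _ => le_rfl⟩

theorem Dominates.trans {X : Set (H × R)} {m t s : H × R} (h : Dominates X m t)
    (h' : Dominates X t s) : Dominates X m s :=
  ⟨h.1.trans h'.1, fun x hx => (h.2 x hx).trans (h'.2 x hx)⟩

theorem Dominates.mono {X Y : Set (H × R)} {m t : H × R} (h : Dominates Y m t) (hXY : X ⊆ Y) :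
    Dominates X m t :=
  ⟨h.1, fun x hx => h.2 x (hXY hx)⟩

variable [Monoid H]

theorem Dominates.mul {X Y : Set (H × R)} {m t m' t' : H × R} (h : Dominates X m t)
    (h' : Dominates Y m' t') (hXY : ∀ x ∈ X, x * t ∈ Y) : Dominates X (m * m') (t * t') := by
  refine ⟨?_, fun x hx => ?_⟩
  · rw [Prod.fst_mul, Prod.fst_mul, h.1, h'.1]
  · rw [Prod.snd_mul, Prod.snd_mul, ← mul_assoc, ← mul_assoc]
    exact (mul_le_mul_left (h.2 x hx) _).trans (h'.2 _ (hXY x hx))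

/-- A set of pairs is `ω`-closed when its fibre over `1` is closed under `r ↦ r^ω + r^(ω+1)`. -/
def OmegaClosed (T : Set (H × R)) : Prop :=
  ∀ r : R, (1, r) ∈ T → ((1, r ^ omega R + r ^ (omega R + 1)) : H × R) ∈ T

/-- An idempotent acting injectively acts trivially. -/
theorem mul_eq_self_of_isIdempotentElem {M : Type*} [Monoid M] {X : Set M} {e : M}
    (he : IsIdempotentElem e) (hX : ∀ x ∈ X, x * e ∈ X) (hinj : Set.InjOn (· * e) X) {x : M}
    (hx : x ∈ X) : x * e = x :=
  hinj (hX x hx) hx (by simp only [mul_assoc, he.eq])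

theorem injOn_mul_pow {M : Type*} [Monoid M] {X : Set M} {m : M} (hX : ∀ x ∈ X, x * m ∈ X)
    (hinj : Set.InjOn (· * m) X) (n : ℕ) :
    (∀ x ∈ X, x * m ^ n ∈ X) ∧ Set.InjOn (· * m ^ n) X := by
  induction n with
  | zero => simp [Set.InjOn]
  | succ n ih =>
    refine ⟨fun x hx => ?_, fun x hx y hy h => ?_⟩
    · rw [pow_succ, ← mul_assoc]
      exact hX _ (ih.1 x hx)
    · simp only [pow_succ, ← mul_assoc] at h
      exact ih.2 hx hy (hinj (ih.1 x hx) (ih.1 y hy) h)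

/-- If `u = (1, r)` acts injectively on `X`, then `r^ω` acts trivially, so that `r^ω + r^(ω+1)`
acts as `1 + r`. The product of these elements over all `u ∈ U` therefore dominates `1` and every
element of `U`. -/
theorem exists_dominates_of_injOn [Finite R] {X : Set (H × R)} {T : Submonoid (H × R)}
    (hT : OmegaClosed (T : Set (H × R))) (hXT : ∀ x ∈ X, ∀ t ∈ T, x * t ∈ X)
    {U : Set (H × R)} (hU : U.Finite)
    (h : ∀ u ∈ U, u ∈ T ∧ u.1 = 1 ∧ Set.InjOn (· * u) X) :
    ∃ p ∈ T, Dominates X 1 p ∧ ∀ u ∈ U, Dominates X u p := by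
  induction U, hU using Set.Finite.induction_on with
  | empty => exact ⟨1, T.one_mem, Dominates.refl _ _, fun u hu => hu.elim⟩
  | @insert u U _ _ ih =>
    obtain ⟨p, hp, h1, hpU⟩ := ih fun u hu => h u (Set.mem_insert_of_mem _ hu)
    obtain ⟨huT, hu1, hinj⟩ := h u (Set.mem_insert _ _)
    obtain ⟨g, r⟩ := u
    obtain rfl : g = 1 := hu1
    have hpow : ∀ n : ℕ, ((1, r) : H × R) ^ n = (1, r ^ n) := fun n => by
      rw [Prod.pow_mk, one_pow]
    obtain ⟨hX', hinj'⟩ := injOn_mul_pow (fun x hx => hXT x hx _ huT) hinj (omega R)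
    have hid : ∀ x ∈ X, x.2 * r ^ omega R = x.2 := by
      intro x hx
      have he : IsIdempotentElem (((1, r) : H × R) ^ omega R) := by
        rw [hpow]
        exact Prod.ext (one_mul _) ((omega_spec R).2 r)
      have := congrArg Prod.snd (mul_eq_self_of_isIdempotentElem he hX' hinj' hx)
      rwa [hpow, Prod.snd_mul] at this
    have hv : ∀ x ∈ X, x.2 * (r ^ omega R + r ^ (omega R + 1)) = x.2 + x.2 * r := by
      intro x hx
      rw [mul_add, pow_succ, ← mul_assoc, hid x hx]
    have hv1 : Dominates X 1 ((1, r ^ omega R + r ^ (omega R + 1)) : H × R) := by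
      refine ⟨rfl, fun x hx => ?_⟩
      rw [hv x hx, Prod.snd_one, mul_one]
      exact le_self_add
    have hvu : Dominates X (1, r) ((1, r ^ omega R + r ^ (omega R + 1)) : H × R) := by
      refine ⟨rfl, fun x hx => ?_⟩
      rw [hv x hx]
      exact le_add_self
    have hXp : ∀ x ∈ X, x * p ∈ X := fun x hx => hXT x hx p hp
    refine ⟨p * (1, r ^ omega R + r ^ (omega R + 1)), T.mul_mem hp (hT r huT), ?_, ?_⟩
    · have := h1.mul hv1 hXp
      rwa [one_mul] at this
    · rintro u (rfl | hu)
      · have := h1.mul hvu hXp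
        rwa [one_mul] at this
      · have := (hpU u hu).mul hv1 hXp
        rwa [mul_one] at this

end Domination

/-! ### Words and products -/

section Words

variable {H : Type*} [Monoid H] {R : Type*} [IdemSemiring R] {B : Type*}

/-- The languages recognized by the `H`-component of a map `α : B → H × R`. -/
def fstLanguages (α : B → H × R) : Set (Language B) :=
  {L | ∃ F : Set H, L = {w | (w.map α).prod.1 ∈ F}}

theorem fstLanguages_isLatticeClass (α : B → H × R) : IsLatticeClass (fstLanguages α) where
  empty_mem := ⟨∅, rfl⟩
  univ_mem := ⟨Set.univ, rfl⟩
  union_mem := by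
    rintro _ ⟨F, rfl⟩ _ ⟨F', rfl⟩
    exact ⟨F ∪ F', rfl⟩
  inter_mem := by
    rintro _ ⟨F, rfl⟩ _ ⟨F', rfl⟩
    exact ⟨F ∩ F', rfl⟩

theorem map_prod_mem {M : Type*} [Monoid M] {T : Submonoid M} {α : B → M} (h : ∀ b, α b ∈ T)
    (w : List B) : (w.map α).prod ∈ T :=
  T.list_prod_mem fun m hm => by
    obtain ⟨b, -, rfl⟩ := List.mem_map.mp hm
    exact h b

theorem injOn_mul_map_prod {M : Type*} [Monoid M] {X : Set M} {α : B → M} {D : Finset B}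
    (hX : ∀ x ∈ X, ∀ b, x * α b ∈ X) (h : ∀ b ∈ D, Set.InjOn (· * α b) X) {w : List B}
    (hw : w ∈ wordsOver D) : Set.InjOn (· * (w.map α).prod) X := by
  induction w with
  | nil => simp [Set.InjOn]
  | cons b w ih =>
    intro x hx y hy hxy
    simp only [List.map_cons, List.prod_cons, ← mul_assoc] at hxy
    rw [mem_wordsOver] at hw
    have hw' : w ∈ wordsOver D := fun a ha => hw a (List.mem_cons_of_mem _ ha)
    exact h b (hw b List.mem_cons_self) hx hy (ih hw' (hX x hx b) (hX y hy b) hxy)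

/-- When all letters act injectively, the words with a given `H`-component are dominated by a single
element of `T`. -/
theorem exists_dominates_fst_eq [Finite H] [Finite R] (hH : ∀ e : H, IsIdempotentElem e → e = 1)
    {X : Set (H × R)} {T : Submonoid (H × R)} (hT : OmegaClosed (T : Set (H × R)))
    (hXT : ∀ x ∈ X, ∀ t ∈ T, x * t ∈ X) {α : B → H × R} (hα : ∀ b, α b ∈ T) {D : Finset B}
    (hinj : ∀ b ∈ D, Set.InjOn (· * α b) X) (g : H) :
    ∃ t ∈ T, ∀ w ∈ wordsOver D, (w.map α).prod.1 = g → Dominates X (w.map α).prod t := by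
  by_cases hne : ∃ w₀ ∈ wordsOver D, (w₀.map α).prod.1 = g
  swap
  · exact ⟨1, T.one_mem, fun w hw hg => (hne ⟨w, hw, hg⟩).elim⟩
  obtain ⟨w₀, hw₀, hg₀⟩ := hne
  have hinjw : ∀ w ∈ wordsOver D, Set.InjOn (· * (w.map α).prod) X := fun w hw =>
    injOn_mul_map_prod (fun x hx b => hXT x hx _ (hα b)) hinj hw
  set m₀ := (w₀.map α).prod
  have hm₀ : m₀ ∈ T := map_prod_mem hα w₀
  obtain ⟨hω, hidem⟩ := omega_spec (H × R)
  obtain ⟨n, hn⟩ := Nat.exists_eq_add_of_lt hω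
  rw [zero_add] at hn
  have hg1 : g ^ (n + 1) = 1 := by
    refine hH _ ?_
    have := congrArg Prod.fst (hidem m₀).eq
    rwa [Prod.fst_mul, Prod.pow_fst, hg₀, hn] at this
  have hpow := fun k => injOn_mul_pow (fun x hx => hXT x hx _ hm₀) (hinjw w₀ hw₀) k
  have hid : ∀ x ∈ X, x * m₀ ^ (n + 1) = x := fun x hx =>
    mul_eq_self_of_isIdempotentElem (hn ▸ hidem m₀) (hpow _).1 (hpow _).2 hx
  -- `m₀ ^ n` is an inverse of `m₀` on `X`: it brings the words back to the fibre over `1`.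
  obtain ⟨p, hp, -, hpU⟩ := exists_dominates_of_injOn hT hXT
    (Set.toFinite {u : H × R | u ∈ T ∧ u.1 = 1 ∧ Set.InjOn (· * u) X}) fun u hu => hu
  refine ⟨p * m₀, T.mul_mem hp hm₀, fun w hw hg => ?_⟩
  have hwT : (w.map α).prod ∈ T := map_prod_mem hα w
  have hu : (w.map α).prod * m₀ ^ n ∈ {u : H × R | u ∈ T ∧ u.1 = 1 ∧ Set.InjOn (· * u) X} := by
    refine ⟨T.mul_mem hwT (T.pow_mem hm₀ n), ?_, ?_⟩
    · rw [Prod.fst_mul, Prod.pow_fst, hg, hg₀, ← pow_succ', hg1]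
    · intro x hx y hy h
      simp only [← mul_assoc] at h
      exact hinjw w hw hx hy ((hpow n).2 (hXT x hx _ hwT) (hXT y hy _ hwT) h)
  have hdom := (hpU _ hu).mul (Dominates.refl X m₀) fun x hx => hXT x hx p hp
  rw [mul_assoc, ← pow_succ] at hdom
  refine Dominates.trans ⟨?_, fun x hx => le_of_eq ?_⟩ hdom
  · rw [Prod.fst_mul, Prod.pow_fst, hg, hg₀, hg1, mul_one]
  · have := congrArg Prod.snd (hid _ (hXT x hx _ hwT))
    rw [mul_assoc, Prod.snd_mul, Prod.snd_mul x] at this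
    exact this.symm

end Words

/-! ### Factorizations along a letter -/

section Factor

variable {B C : Type*}

/-- `Factors κ D b u c` means that `u = w₁ b ⋯ wₙ b` where the words `wᵢ` only use letters of `D`,
and that `c` is the word `κ w₁ ⋯ κ wₙ`. -/
inductive Factors (κ : List B → C) (D : Finset B) (b : B) : List B → List C → Prop
  | nil : Factors κ D b [] []
  | cons {w u : List B} {c : List C} :
      w ∈ wordsOver D → Factors κ D b u c → Factors κ D b (w ++ b :: u) (κ w :: c)

variable {κ : List B → C} {D : Finset B} {b : B}

theorem Factors.append {u v : List B} {c d : List C} (h : Factors κ D b u c)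
    (h' : Factors κ D b v d) : Factors κ D b (u ++ v) (c ++ d) := by
  induction h with
  | nil => exact h'
  | cons hw _ ih => simpa using Factors.cons hw ih

theorem Factors.exists_of_append {u : List B} {c d : List C} (h : Factors κ D b u (c ++ d)) :
    ∃ v v', u = v ++ v' ∧ Factors κ D b v c ∧ Factors κ D b v' d := by
  induction c generalizing u with
  | nil => exact ⟨[], u, rfl, .nil, h⟩
  | cons x c ih =>
    cases h with
    | cons hw h =>
      obtain ⟨v, v', rfl, hv, hv'⟩ := ih h
      exact ⟨_, v', by simp, .cons hw hv, hv'⟩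

theorem append_cons_inj {w w' u u' : List B} (h : b ∉ w) (h' : b ∉ w')
    (heq : w ++ b :: u = w' ++ b :: u') : w = w' ∧ u = u' := by
  induction w generalizing w' with
  | nil =>
    cases w' with
    | nil => exact ⟨rfl, (List.cons.inj heq).2⟩
    | cons a w' => exact (h' (List.mem_cons.mpr (.inl (List.cons.inj heq).1))).elim
  | cons a w ih =>
    cases w' with
    | nil => exact (h (List.mem_cons.mpr (.inl (List.cons.inj heq).1.symm))).elim
    | cons a' w' =>
      simp only [List.mem_cons, not_or, List.cons_append, List.cons.injEq] at h h' heq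
      exact ⟨by rw [heq.1, (ih h.2 h'.2 heq.2).1], (ih h.2 h'.2 heq.2).2⟩

theorem Factors.unique (hb : b ∉ D) {u : List B} {c d : List C} (h : Factors κ D b u c)
    (h' : Factors κ D b u d) : c = d := by
  induction h generalizing d with
  | nil =>
    generalize hv : ([] : List B) = v at h'
    cases h' with
    | nil => rfl
    | cons _ _ => simp at hv
  | @cons w u c hw _ ih =>
    generalize hv : w ++ b :: u = v at h'
    cases h' with
    | nil => simp at hv
    | @cons w' u' c' hw' h' =>
      obtain ⟨rfl, rfl⟩ := append_cons_inj (fun h => hb (hw b h)) (fun h => hb (hw' b h)) hv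
      rw [ih h']

/-- Every word is a factorized word followed by a word without `b`. -/
theorem exists_factors_append [DecidableEq B] (κ : List B → C) (b : B) {v : List B}
    (hv : v ∈ wordsOver D) :
    ∃ u c w, v = u ++ w ∧ Factors κ (D.erase b) b u c ∧ w ∈ wordsOver (D.erase b) := by
  induction hn : v.length using Nat.strong_induction_on generalizing v with
  | _ n ih =>
    by_cases hb : b ∈ v
    · obtain ⟨w, v, rfl, hw⟩ := List.eq_append_cons_of_mem hb
      obtain ⟨u, c, w', rfl, hc, hw'⟩ := ih v.length (by simp at hn; omega)
        (fun a ha => hv a (by simp [ha])) rfl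
      refine ⟨w ++ b :: u, κ w :: c, w', by simp, .cons (fun a ha => ?_) hc, hw'⟩
      exact Finset.mem_erase.mpr ⟨fun h => hw (h ▸ ha), hv a (by simp [ha])⟩
    · refine ⟨[], [], v, rfl, .nil, fun a ha => ?_⟩
      exact Finset.mem_erase.mpr ⟨fun h => hb (h ▸ ha), hv a ha⟩

/-- The words having a factorization along `b` are the empty word and the words ending in `b`. -/
theorem exists_factors_iff [DecidableEq B] {u : List B} (κ : List B → C) (hb : b ∈ D) :
    (∃ c, Factors κ (D.erase b) b u c) ↔ u ∈ wordsOver D ⊓ (wordsOver ∅ ⊔ ⊤ * {[b]}) := by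
  constructor
  · rintro ⟨c, h⟩
    induction h with
    | nil =>
      exact ⟨fun a ha => (List.not_mem_nil ha).elim, .inl fun a ha => (List.not_mem_nil ha).elim⟩
    | @cons w u c hw _ ih =>
      refine ⟨?_, .inr ?_⟩
      · intro a ha
        rcases List.mem_append.mp ha with h | h
        · exact Finset.mem_of_mem_erase (hw a h)
        · rcases List.mem_cons.mp h with rfl | h
          · exact hb
          · exact ih.1 a h
      · rcases ih.2 with h | ⟨v, _, _, rfl, rfl⟩
        · have hu : u = [] :=
            List.eq_nil_iff_forall_not_mem.mpr fun a ha => Finset.notMem_empty _ (h a ha)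
          exact ⟨w, trivial, [b], rfl, by simp [hu]⟩
        · exact ⟨w ++ b :: v, trivial, [b], rfl, by simp⟩
  · rintro ⟨hD, h | ⟨v, -, _, rfl, rfl⟩⟩
    · have hu : u = [] :=
        List.eq_nil_iff_forall_not_mem.mpr fun a ha => Finset.notMem_empty _ (h a ha)
      exact ⟨[], hu ▸ .nil⟩
    · obtain ⟨u, c, w, rfl, hc, hw⟩ := exists_factors_append (D := D) κ b
        (v := v) fun a ha => hD a (List.mem_append_left _ ha)
      exact ⟨_, by simpa using hc.append (.cons hw .nil)⟩

/-- The words whose factorization along `b` is coded by a word of `U`. -/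
def factorLanguage (κ : List B → C) (D : Finset B) (b : B) (U : Language C) : Language B :=
  {u | ∃ c ∈ U, Factors κ D b u c}

theorem mem_factorLanguage {U : Language C} {u : List B} :
    u ∈ factorLanguage κ D b U ↔ ∃ c ∈ U, Factors κ D b u c :=
  Iff.rfl

theorem factorLanguage_mem_SF {𝒞 : Set (Language B)} (h𝒞 : IsLatticeClass 𝒞)
    {𝒞' : Set (Language C)} (hb : b ∉ D) (htop : factorLanguage κ D b ⊤ ∈ SF 𝒞)
    (hκ : ∀ c, ({w | w ∈ wordsOver D ∧ κ w = c} : Language B) ∈ SF 𝒞)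
    (hbase : ∀ U ∈ 𝒞', factorLanguage κ D b U ∈ SF 𝒞) {U : Language C} (hU : InSF 𝒞' U) :
    factorLanguage κ D b U ∈ SF 𝒞 := by
  induction hU with
  | base h => exact hbase _ h
  | letter c =>
    have h : factorLanguage κ D b {[c]} =
        (show Language B from {w | w ∈ wordsOver D ∧ κ w = c}) * {[b]} := by
      ext u
      constructor
      · rintro ⟨_, rfl, h⟩
        cases h with
        | cons hw h =>
          cases h with
          | nil => exact ⟨_, ⟨hw, rfl⟩, [b], rfl, rfl⟩
      · rintro ⟨w, ⟨hw, rfl⟩, _, rfl, rfl⟩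
        exact ⟨_, rfl, .cons hw .nil⟩
    rw [h]
    exact .concat (hκ c) (.letter b)
  | @union K L _ _ h1 h2 =>
    have h : factorLanguage κ D b (K ⊔ L) = factorLanguage κ D b K ⊔ factorLanguage κ D b L := by
      ext u
      simp only [mem_factorLanguage, mem_sup, or_and_right, exists_or]
    rw [h]
    exact .union h1 h2
  | @compl K _ h1 =>
    have h : factorLanguage κ D b Kᶜ = factorLanguage κ D b ⊤ ⊓ (factorLanguage κ D b K)ᶜ := by
      ext u
      rw [mem_inf, mem_compl, mem_factorLanguage, mem_factorLanguage, mem_factorLanguage]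
      constructor
      · rintro ⟨c, hc, h⟩
        refine ⟨⟨c, trivial, h⟩, ?_⟩
        rintro ⟨d, hd, h'⟩
        exact hc (h.unique hb h' ▸ hd)
      · rintro ⟨⟨c, -, h⟩, hc⟩
        exact ⟨c, fun h' => hc ⟨c, h', h⟩, h⟩
    rw [h]
    exact (SF_isLatticeClass h𝒞).inter_mem _ htop _ (.compl h1)
  | @concat K L _ _ h1 h2 =>
    have h : factorLanguage κ D b (K * L) = factorLanguage κ D b K * factorLanguage κ D b L := by
      ext u
      constructor
      · rintro ⟨_, ⟨c, hc, d, hd, rfl⟩, h⟩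
        obtain ⟨v, v', rfl, hv, hv'⟩ := h.exists_of_append
        exact ⟨v, ⟨c, hc, hv⟩, v', ⟨d, hd, hv'⟩, rfl⟩
      · rintro ⟨v, ⟨c, hc, hv⟩, v', ⟨d, hd, hv'⟩, rfl⟩
        exact ⟨_, ⟨c, hc, d, hd, rfl⟩, hv.append hv'⟩
    rw [h]
    exact .concat h1 h2

variable {H : Type*} [Monoid H] {R : Type*} [IdemSemiring R]

/-- If `β (κ w)` dominates `α w b` for all `w`, the code of a factorization dominates the word. -/
theorem Factors.dominates {α : B → H × R} {β : C → H × R} {X : Set (H × R)}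
    (h : ∀ w ∈ wordsOver D, Dominates X ((w.map α).prod * α b) (β (κ w)))
    (hX : ∀ x ∈ X, ∀ c, x * β c ∈ X) {u : List B} {c : List C} (hu : Factors κ D b u c) :
    Dominates X (u.map α).prod (c.map β).prod := by
  induction hu with
  | nil => exact .refl _ _
  | cons hw _ ih =>
    have := (h _ hw).mul ih fun x hx => hX x hx _
    simpa [mul_assoc] using this

end Factor

/-! ### Dominated covers -/

section Cover

variable {H : Type*} [Monoid H] {R : Type*} [IdemSemiring R]

/-- The submonoid `{1} ∪ T a` for `a ∈ T`. -/
def blockSubmonoid {M : Type*} [Monoid M] (T : Submonoid M) {a : M} (ha : a ∈ T) :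
    Submonoid M where
  carrier := {m | m = 1 ∨ ∃ t ∈ T, m = t * a}
  one_mem' := .inl rfl
  mul_mem' := by
    rintro _ _ (rfl | ⟨t, ht, rfl⟩) (rfl | ⟨t', ht', rfl⟩)
    · exact .inl (one_mul _)
    · exact .inr ⟨t', ht', one_mul _⟩
    · exact .inr ⟨t, ht, mul_one _⟩
    · exact .inr ⟨t * a * t', T.mul_mem (T.mul_mem ht ha) ht', (mul_assoc _ _ _).symm⟩

theorem blockSubmonoid_le {M : Type*} [Monoid M] {T : Submonoid M} {a : M} (ha : a ∈ T) :
    blockSubmonoid T ha ≤ T := by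
  rintro _ (rfl | ⟨t, ht, rfl⟩)
  · exact T.one_mem
  · exact T.mul_mem ht ha

theorem omegaClosed_blockSubmonoid [Finite R] {T : Submonoid (H × R)}
    (hT : OmegaClosed (T : Set (H × R))) {a : H × R} (ha : a ∈ T) :
    OmegaClosed (blockSubmonoid T ha : Set (H × R)) := by
  intro r hr
  have hrT : ((1, r) : H × R) ∈ T := blockSubmonoid_le ha hr
  rcases hr with hr | ⟨t, ht, hr⟩
  · left
    have hr1 : r = 1 := (Prod.ext_iff.mp hr).2
    rw [hr1, one_pow, one_pow, add_idem]
    rfl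
  · right
    obtain ⟨hω, hidem⟩ := omega_spec R
    obtain ⟨n, hn⟩ := Nat.exists_eq_add_of_lt hω
    rw [zero_add] at hn
    -- `r^ω + r^(ω+1)` absorbs `r^ω = r^(ω-1) r` on the right, and `r` ends with `a`.
    have habs : (r ^ omega R + r ^ (omega R + 1)) * (r ^ n * r) =
        r ^ omega R + r ^ (omega R + 1) := by
      rw [← pow_succ, ← hn, add_mul, (hidem r).eq, pow_succ', mul_assoc, (hidem r).eq]
    refine ⟨(1, r ^ omega R + r ^ (omega R + 1)) * (1, r) ^ n * t,
      T.mul_mem (T.mul_mem (hT r hrT) (T.pow_mem hrT n)) ht, ?_⟩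
    rw [mul_assoc, ← hr, Prod.pow_mk, one_pow]
    exact Prod.ext (by simp) ((mul_assoc _ _ _).trans habs).symm

/-- A finite cover of the words over `D` by star-free languages over the `H`-component of `α`, each
of which is dominated on `X` by a single element of `T`. -/
structure IsDominatedCover {B : Type*} (α : B → H × R) (X T : Set (H × R)) (D : Finset B)
    (𝒦 : Set (Language B)) : Prop where
  finite : 𝒦.Finite
  covers : ∀ w ∈ wordsOver D, ∃ K ∈ 𝒦, w ∈ K
  mem_SF : ∀ K ∈ 𝒦, K ∈ SF (fstLanguages α)
  dominated : ∀ K ∈ 𝒦, ∃ t ∈ T, ∀ w ∈ K, Dominates X (w.map α).prod t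

theorem exists_isDominatedCover_of_injOn [Finite H] [Finite R]
    (hH : ∀ e : H, IsIdempotentElem e → e = 1) {B : Type*} [Finite B] {α : B → H × R}
    {X : Set (H × R)} {T : Submonoid (H × R)} (hT : OmegaClosed (T : Set (H × R)))
    (hXT : ∀ x ∈ X, ∀ t ∈ T, x * t ∈ X) (hα : ∀ b, α b ∈ T) {D : Finset B}
    (hinj : ∀ b ∈ D, Set.InjOn (· * α b) X) : ∃ 𝒦, IsDominatedCover α X T D 𝒦 := by
  refine ⟨Set.range fun g : H => (wordsOver D ⊓ {w | (w.map α).prod.1 ∈ ({g} : Set H)} :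
    Language B), Set.finite_range _, fun w hw => ⟨_, ⟨_, rfl⟩, hw, rfl⟩, ?_, ?_⟩
  · rintro _ ⟨g, rfl⟩
    have hC := fstLanguages_isLatticeClass α
    exact (SF_isLatticeClass hC).inter_mem _ (wordsOver_mem hC D) _ (.base ⟨{g}, rfl⟩)
  · rintro _ ⟨g, rfl⟩
    obtain ⟨t, ht, h⟩ := exists_dominates_fst_eq hH hT hXT hα hinj g
    exact ⟨t, ht, fun w hw => h w hw.1 hw.2⟩

universe u

/-- The inductive step: a letter `b` whose action on `X` is not injective is used as a separator.
The blocks between two occurrences of `b` become the letters of a new alphabet acting on `X b`. -/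
theorem exists_isDominatedCover_of_erase [Finite R] {B : Type u} [Finite B] [DecidableEq B]
    {α : B → H × R} {X : Set (H × R)} {T : Submonoid (H × R)}
    (hXT : ∀ x ∈ X, ∀ t ∈ T, x * t ∈ X) (hα : ∀ b, α b ∈ T) {D : Finset B} {b : B} (hb : b ∈ D)
    {𝒦 : Set (Language B)} (h𝒦 : IsDominatedCover α X T (D.erase b) 𝒦)
    (ih : ∀ {C : Type u} [Finite C] (β : C → H × R), (∀ c, β c ∈ blockSubmonoid T (hα b)) →
      ∀ D' : Finset C, ∃ 𝒰,
        IsDominatedCover β ((· * α b) '' X) (blockSubmonoid T (hα b)) D' 𝒰) :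
    ∃ 𝒦', IsDominatedCover α X T D 𝒦' := by
  have hC := fstLanguages_isLatticeClass α
  have hSF := SF_isLatticeClass hC
  have hbD : b ∉ D.erase b := Finset.notMem_erase b D
  have : Finite 𝒦 := h𝒦.finite
  choose t ht hdom using h𝒦.dominated
  -- A block is coded by the set of members of the cover that contain it.
  let κ : List B → Set 𝒦 := fun w => {K | w ∈ K.1}
  classical
  let τ : Set 𝒦 → H × R := fun s => if h : s.Nonempty then t h.some.1 h.some.2 else 1
  have hτ : ∀ s, τ s ∈ T := by
    intro s
    by_cases h : s.Nonempty
    · simp only [τ, dif_pos h]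
      exact ht _ _
    · simp only [τ, dif_neg h]
      exact T.one_mem
  have hκτ : ∀ w ∈ wordsOver (D.erase b), Dominates X (w.map α).prod (τ (κ w)) := by
    intro w hw
    have h : (κ w).Nonempty := by
      obtain ⟨K, hK, hwK⟩ := h𝒦.covers w hw
      exact ⟨⟨K, hK⟩, hwK⟩
    simp only [τ, dif_pos h]
    exact hdom _ _ w h.some_mem
  let β : Set 𝒦 → H × R := fun s => τ s * α b
  have hβ : ∀ s, β s ∈ blockSubmonoid T (hα b) := fun s => .inr ⟨τ s, hτ s, rfl⟩
  have := Fintype.ofFinite (Set 𝒦)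
  obtain ⟨𝒰, h𝒰⟩ := ih β hβ Finset.univ
  have hfac : ∀ {u c}, Factors κ (D.erase b) b u c → Dominates X (u.map α).prod (c.map β).prod :=
    fun hu => hu.dominates (fun w hw => (hκτ w hw).mul (.refl _ _) fun x hx => hXT x hx _ (hτ _))
      fun x hx c => hXT x hx _ (blockSubmonoid_le _ (hβ c))
  have htop : factorLanguage κ (D.erase b) b ⊤ ∈ SF (fstLanguages α) := by
    have h : factorLanguage κ (D.erase b) b ⊤ =
        wordsOver D ⊓ (wordsOver ∅ ⊔ ⊤ * {[b]}) := by
      ext u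
      rw [← exists_factors_iff κ hb]
      exact exists_congr fun c => and_iff_right trivial
    rw [h]
    exact hSF.inter_mem _ (wordsOver_mem hC D) _ (.union (wordsOver_mem hC ∅)
      (.concat (.base hC.univ_mem) (.letter b)))
  have hfib : ∀ s, ({w | w ∈ wordsOver (D.erase b) ∧ κ w = s} : Language B) ∈
      SF (fstLanguages α) := by
    intro s
    have h : ({w | w ∈ wordsOver (D.erase b) ∧ κ w = s} : Language B) = wordsOver (D.erase b) ⊓
        (show Language B from {w | ∀ K ∈ 𝒦, w ∈ K ↔ K ∈ Subtype.val '' s}) := by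
      ext w
      refine and_congr Iff.rfl (Set.ext_iff.trans ?_)
      refine Subtype.forall.trans (forall₂_congr fun K hK => iff_congr Iff.rfl ?_)
      simp [hK]
    rw [h]
    exact hSF.inter_mem _ (wordsOver_mem hC _) _
      (atom_mem hSF (fun K hK => .compl hK) h𝒦.finite h𝒦.mem_SF _)
  have hbase : ∀ U ∈ fstLanguages β, factorLanguage κ (D.erase b) b U ∈ SF (fstLanguages α) := by
    rintro _ ⟨F, rfl⟩
    have h : factorLanguage κ (D.erase b) b {c | (c.map β).prod.1 ∈ F} =
        factorLanguage κ (D.erase b) b ⊤ ⊓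
          (show Language B from {u | (u.map α).prod.1 ∈ F}) := by
      ext u
      constructor
      · rintro ⟨c, hc, hu⟩
        exact ⟨⟨c, trivial, hu⟩, by
          change (u.map α).prod.1 ∈ F
          rw [(hfac hu).1]
          exact hc⟩
      · rintro ⟨⟨c, -, hu⟩, hF⟩
        exact ⟨c, by
          change (c.map β).prod.1 ∈ F
          rw [← (hfac hu).1]
          exact hF, hu⟩
    rw [h]
    exact hSF.inter_mem _ htop _ (.base ⟨F, rfl⟩)
  refine ⟨𝒦 ∪ (fun q : Language B × Language (Set 𝒦) × Language B =>
    q.1 * {[b]} * factorLanguage κ (D.erase b) b q.2.1 * q.2.2) '' (𝒦 ×ˢ 𝒰 ×ˢ 𝒦), ?_, ?_, ?_, ?_⟩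
  · exact h𝒦.finite.union ((h𝒦.finite.prod (h𝒰.finite.prod h𝒦.finite)).image _)
  · intro w hw
    by_cases hbw : b ∈ w
    · obtain ⟨w₀, v, rfl, hw₀⟩ := List.eq_append_cons_of_mem hbw
      obtain ⟨u, c, w₁, rfl, hu, hw₁⟩ := exists_factors_append (D := D) κ b (v := v)
        fun a ha => hw a (List.mem_append_right _ (List.mem_cons_of_mem _ ha))
      obtain ⟨K₀, hK₀, h₀⟩ := h𝒦.covers w₀ fun a ha => Finset.mem_erase.mpr
        ⟨fun h => hw₀ (h ▸ ha), hw a (List.mem_append_left _ ha)⟩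
      obtain ⟨K₁, hK₁, h₁⟩ := h𝒦.covers w₁ hw₁
      obtain ⟨U, hU, hcU⟩ := h𝒰.covers c fun _ _ => Finset.mem_univ _
      refine ⟨_, .inr ⟨(K₀, U, K₁), ⟨hK₀, hU, hK₁⟩, rfl⟩, ?_⟩
      exact ⟨_, ⟨_, ⟨w₀, h₀, [b], rfl, rfl⟩, u, ⟨c, hcU, hu⟩, rfl⟩, w₁, h₁, by simp⟩
    · obtain ⟨K, hK, hwK⟩ := h𝒦.covers w fun a ha => Finset.mem_erase.mpr
        ⟨fun h => hbw (h ▸ ha), hw a ha⟩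
      exact ⟨K, .inl hK, hwK⟩
  · rintro _ (hK | ⟨⟨K₀, U, K₁⟩, ⟨hK₀, hU, hK₁⟩, rfl⟩)
    · exact h𝒦.mem_SF _ hK
    · exact .concat (.concat (.concat (h𝒦.mem_SF _ hK₀) (.letter b))
        (factorLanguage_mem_SF hC hbD htop hfib hbase (h𝒰.mem_SF _ hU))) (h𝒦.mem_SF _ hK₁)
  · rintro _ (hK | ⟨⟨K₀, U, K₁⟩, ⟨hK₀, hU, hK₁⟩, rfl⟩)
    · exact ⟨_, ht _ hK, hdom _ hK⟩
    · obtain ⟨s, hs, hdomU⟩ := h𝒰.dominated U hU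
      have hsT := blockSubmonoid_le _ hs
      have htb : t K₀ hK₀ * α b ∈ T := T.mul_mem (ht _ hK₀) (hα b)
      refine ⟨t K₀ hK₀ * α b * s * t K₁ hK₁, T.mul_mem (T.mul_mem htb hsT) (ht _ hK₁), ?_⟩
      rintro _ ⟨_, ⟨_, ⟨w₀, h₀, _, rfl, rfl⟩, u, ⟨c, hcU, hu⟩, rfl⟩, w₁, h₁, rfl⟩
      have hX' : (· * α b) '' X ⊆ X := by
        rintro _ ⟨x, hx, rfl⟩
        exact hXT x hx _ (hα b)
      have hu' := ((hfac hu).mono hX').trans (hdomU c hcU)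
      have h1 := (((hdom _ hK₀ w₀ h₀).mul (.refl X (α b)) fun x hx => hXT x hx _ (ht _ hK₀)).mul
        hu' fun x hx => ⟨_, hXT x hx _ (ht _ hK₀), mul_assoc _ _ _⟩).mul (hdom _ hK₁ w₁ h₁)
        fun x hx => hXT x hx _ (T.mul_mem htb hsT)
      simpa [mul_assoc] using h1

theorem exists_isDominatedCover [Finite H] [Finite R]
    (hH : ∀ e : H, IsIdempotentElem e → e = 1) {B : Type u} [Finite B] {α : B → H × R}
    {X : Set (H × R)} {T : Submonoid (H × R)} (hT : OmegaClosed (T : Set (H × R)))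
    (hXT : ∀ x ∈ X, ∀ t ∈ T, x * t ∈ X) (hα : ∀ b, α b ∈ T) (D : Finset B) :
    ∃ 𝒦, IsDominatedCover α X T D 𝒦 := by
  classical
  induction hn : X.ncard using Nat.strong_induction_on generalizing B X T with
  | _ n ih =>
    subst hn
    induction D using Finset.strongInduction with
    | H D ihD =>
      by_cases hinj : ∀ b ∈ D, Set.InjOn (· * α b) X
      · exact exists_isDominatedCover_of_injOn hH hT hXT hα hinj
      · push Not at hinj
        obtain ⟨b, hb, hinj⟩ := hinj
        obtain ⟨𝒦, h𝒦⟩ := ihD (D.erase b) (Finset.erase_ssubset hb)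
        refine exists_isDominatedCover_of_erase hXT hα hb h𝒦 fun β hβ D' => ?_
        refine ih _ (lt_of_le_of_ne (Set.ncard_image_le X.toFinite) fun h =>
          hinj ((Set.ncard_image_iff X.toFinite).mp h)) (omegaClosed_blockSubmonoid hT (hα b))
          ?_ hβ D' rfl
        rintro _ ⟨x, hx, rfl⟩ _ (rfl | ⟨s, hs, rfl⟩)
        · exact ⟨x, hx, (mul_one _).symm⟩
        · exact ⟨_, hXT _ (hXT x hx _ (hα b)) s hs, mul_assoc _ _ _⟩

end Cover

/-! ### Minimality of the optimal approximation -/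

section Minimality

variable {A : Type*} {R : Type*} [IdemSemiring R]

theorem mul_mem_muLetter_prod {ρ : Language A → R} {S : Set R}
    (hS : ∀ q ∈ S, ∀ r ∈ S, q * r ∈ S) {w : List A} (hw : w ≠ []) {q s : R}
    (hq : q ∈ (w.map (muLetter ρ S)).prod) (hs : s ∈ S) :
    q * s ∈ (w.map (muLetter ρ S)).prod := by
  obtain ⟨w, a, rfl⟩ := (List.eq_nil_or_concat w).resolve_left hw
  simp only [List.concat_eq_append, List.map_append, List.prod_append, List.map_cons,
    List.map_nil, List.prod_singleton] at hq ⊢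
  obtain ⟨x, hx, _, ⟨y, hy, z, hz, rfl⟩, rfl⟩ := hq
  exact ⟨x, hx, _, ⟨y, hy, z * s, hS z hz s hs, rfl⟩, by simp only [mul_assoc]⟩

/-- The pairs `(g, r)` for which some word `w` of class `g` satisfies `r ∈ S μ(w) S`. -/
def muSubmonoid {H : Type*} [Monoid H] (π : FreeMonoid A →* H) (ρ : Language A → R) (S : Set R)
    (h1 : 1 ∈ S) (hS : ∀ q ∈ S, ∀ r ∈ S, q * r ∈ S) : Submonoid (H × R) where
  carrier := {m | ∃ w : List A, π (FreeMonoid.ofList w) = m.1 ∧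
    ∃ s ∈ S, ∃ q ∈ (w.map (muLetter ρ S)).prod, ∃ s' ∈ S, m.2 = s * q * s'}
  one_mem' := ⟨[], map_one π, 1, h1, 1, by simp, 1, h1, by simp⟩
  mul_mem' := by
    rintro m m' ⟨w, hw, s, hs, q, hq, s', hs', hm⟩ ⟨v, hv, t, ht, p, hp, t', ht', hm'⟩
    refine ⟨w ++ v, ?_, ?_⟩
    · rw [FreeMonoid.ofList_append, map_mul, hw, hv, Prod.fst_mul]
    · by_cases hnil : w = []
      · subst hnil
        rw [List.map_nil, List.prod_nil, Set.mem_one] at hq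
        refine ⟨s * s' * t, hS _ (hS _ hs _ hs') _ ht, p, hp, t', ht', ?_⟩
        rw [Prod.snd_mul, hm, hm', hq]
        simp only [mul_assoc, one_mul]
      · refine ⟨s, hs, q * (s' * t) * p, ?_, t', ht', ?_⟩
        · rw [List.map_append, List.prod_append]
          exact ⟨_, mul_mem_muLetter_prod hS hnil hq (hS _ hs' _ ht), p, hp, rfl⟩
        · rw [Prod.snd_mul, hm, hm']
          simp only [mul_assoc]

theorem finite_synCon_quotient {G : Set (Language A)} (hG : IsQuotientAlgebra G) {L : Language A}
    (hL : L ∈ G) : Finite (synCon {L}).Quotient := by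
  have hfin := finite_range_synClass hG (Set.finite_singleton L) (Set.singleton_subset_iff.mpr hL)
  have := hfin.to_subtype
  refine Finite.of_injective (β := Set.range (synClass {L}))
    (fun q => Con.liftOn q (fun u => ⟨synClass {L} u.toList, _, rfl⟩) fun u v h =>
      Subtype.ext (synClass_eq (𝒦 := {L}) (u := v.toList) (v := u.toList) h)) ?_
  intro q q' h
  induction q using Con.induction_on with
  | H u =>
    induction q' using Con.induction_on with
    | H v =>
      refine (Con.eq _).mpr ?_
      have h' : synClass {L} u.toList = synClass {L} v.toList := congrArg Subtype.val h
      have h'' : u.toList ∈ synClass {L} v.toList := h' ▸ mem_synClass_self _ _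
      exact h''

/-- The syntactic monoid of a group language is a group. Only the uniqueness of its idempotent
is needed. -/
theorem IsGroupLanguage.eq_one_of_isIdempotentElem {L : Language A} (hL : IsGroupLanguage L)
    {e : (synCon {L}).Quotient} (he : IsIdempotentElem e) : e = 1 := by
  obtain ⟨H, _, _, φ, F, hφ⟩ := hL
  induction e using Con.induction_on with
  | H u =>
    have hpow : (u : (synCon {L}).Quotient) = (u ^ Nat.card H : FreeMonoid A) :=
      (he.pow_eq Nat.card_pos.ne').symm.trans (map_pow (synCon {L}).mk' u _).symm
    rw [hpow]
    refine (Con.eq _).mpr ?_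
    rintro _ rfl p
    rw [mem_biquotient, mem_biquotient, hφ, hφ]
    simp only [FreeMonoid.ofList_append, FreeMonoid.ofList_toList, map_mul, map_pow,
      pow_card_eq_one', map_one]

theorem epsApprox_nested_subset [Finite A] [Finite R] {G : Set (Language A)}
    (hG : IsGroupPrevariety G) {ρ : Language A →+* R} (hρ : Nice ρ) {S : Set R}
    (hS : SFComplete G ρ S) : epsApprox G (nested (SF G) ρ) ⊆ S := by
  have hQ := hG.isQuotientAlgebra
  obtain ⟨L, hL⟩ := exists_isOptimalEps hG.toIsLatticeClass (mu_monotone ρ S)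
  have hLS : mu ρ S L ⊆ S := epsApprox_eq hL ▸ hS.operation
  have hLG : {L} ⊆ G := Set.singleton_subset_iff.mpr hL.mem_class
  have h1 : (1 : R) ∈ S := hLS ⟨[], hL.nil_mem, by simp⟩
  have := finite_synCon_quotient hQ hL.mem_class
  let π := (synCon {L}).mk'
  let T := muSubmonoid π ρ S h1 hS.mul_mem
  have hπ : ∀ w : List A, π (FreeMonoid.ofList w) = 1 ↔ w ∈ synClass {L} [] := fun w => Con.eq _
  -- Words of class `1` belong to `L`, so that `μ` maps them into `S`.
  have hTS : ∀ r : R, (1, r) ∈ T → r ∈ S := by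
    rintro r ⟨w, hw, s, hs, q, hq, s', hs', hr⟩
    obtain rfl : r = s * q * s' := hr
    have hwL : w ∈ L := (mem_iff_of_mem_synClass ((hπ w).mp hw) rfl).mpr hL.nil_mem
    exact hS.mul_mem _ (hS.mul_mem _ hs _ (hLS ⟨w, hwL, hq⟩)) _ hs'
  have hT : OmegaClosed (T : Set ((synCon {L}).Quotient × R)) := fun r hr =>
    ⟨[], map_one π, _, hS.closure r (hTS r hr), 1, by simp, 1, h1, by simp⟩
  let α : A → (synCon {L}).Quotient × R := fun a => (π (FreeMonoid.of a), ρ {[a]})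
  have hα : ∀ a, α a ∈ T := fun a =>
    ⟨[a], rfl, 1, h1, ρ {[a]}, by simpa using ⟨1, h1, 1, h1, by simp⟩, 1, h1, by simp [α]⟩
  have hαw : ∀ w : List A, (w.map α).prod = (π (FreeMonoid.ofList w), ρ {w}) := by
    intro w
    induction w with
    | nil => exact Prod.ext (map_one π).symm (map_one ρ).symm
    | cons a w ih =>
      rw [List.map_cons, List.prod_cons, ih, ratingMap_cons, FreeMonoid.ofList_cons, map_mul]
      rfl
  have := Fintype.ofFinite A
  obtain ⟨𝒦, h𝒦⟩ := exists_isDominatedCover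
    (fun e he => (hG.group L hL.mem_class).eq_one_of_isIdempotentElem he) (X := T) hT
    (fun x hx t ht => T.mul_mem hx ht) hα Finset.univ
  have hker : synClass {L} [] ∈ G := synClass_mem hQ (Set.finite_singleton L) hLG _
  have hbase : fstLanguages α ⊆ SF G := by
    rintro _ ⟨F, rfl⟩
    have h : ({w | (w.map α).prod.1 ∈ F} : Language A) =
        sSup {K | ∃ u : List A, π (FreeMonoid.ofList u) ∈ F ∧ K = synClass {L} u} := by
      ext w
      refine Iff.trans ?_ mem_sSup.symm
      constructor
      · intro hw
        refine ⟨_, ⟨w, ?_, rfl⟩, mem_synClass_self _ _⟩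
        have hw' : (w.map α).prod.1 ∈ F := hw
        rwa [hαw] at hw'
      · rintro ⟨_, ⟨u, hu, rfl⟩, hw⟩
        change (w.map α).prod.1 ∈ F
        have hwu : π (FreeMonoid.ofList w) = π (FreeMonoid.ofList u) := (Con.eq _).mpr hw
        rwa [hαw, hwu]
    rw [h]
    refine .base (sSup_mem hQ.toIsLatticeClass ((finite_range_synClass hQ
      (Set.finite_singleton L) hLG).subset ?_) ?_)
    · rintro _ ⟨u, -, rfl⟩
      exact ⟨u, rfl⟩
    · rintro _ ⟨u, -, rfl⟩
      exact synClass_mem hQ (Set.finite_singleton L) hLG u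
  have hSF := SF_isLatticeClass hQ.toIsLatticeClass
  have hm := ratingMap_monotone ρ
  intro r hr
  have hr' := (mem_epsApprox_iff hQ.toIsLatticeClass (nested_monotone hSF hm)).mp hr _ hker
    (mem_synClass_self _ _)
  obtain ⟨_, ⟨K, hK, rfl⟩, hrK⟩ := (mem_optImprint_iff hSF hm).mp hr'
    ((· ⊓ synClass {L} []) '' 𝒦) ⟨h𝒦.finite.image _, by
      rintro _ ⟨K, hK, rfl⟩
      exact hSF.inter_mem _ ((h𝒦.mem_SF K hK).mono hbase) _ (.base hker), fun w hw => by
      obtain ⟨K, hK, hwK⟩ := h𝒦.covers w fun _ _ => Finset.mem_univ _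
      exact ⟨_, ⟨K, hK, rfl⟩, hwK, hw⟩⟩
  have hdown : ∀ s ∈ S, r ≤ s → r ∈ S := fun s hs hrs => hS.downset_eq ▸ ⟨s, hs, hrs⟩
  by_cases hne : ∃ w, w ∈ K ⊓ synClass {L} []
  · obtain ⟨w₀, hw₀K, hw₀⟩ := hne
    obtain ⟨t, ht, hdom⟩ := h𝒦.dominated K hK
    have ht1 : t.1 = 1 := by
      rw [← (hdom w₀ hw₀K).1, hαw]
      exact (hπ w₀).mpr hw₀
    refine hdown t.2 (hTS _ (by rw [← ht1]; exact ht)) (hrK.trans (hρ.le_of_forall_word ?_))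
    rintro w ⟨hw, -⟩
    have := (hdom w hw).2 1 T.one_mem
    rwa [hαw, Prod.snd_one, one_mul, one_mul] at this
  · -- An empty language has image `0 ≤ 1`.
    refine hdown 1 h1 (hrK.trans (hρ.le_of_forall_word fun w hw => (hne ⟨w, hw⟩).elim))

end Minimality

end StarFree

theorem theorem10p6 {A : Type*} [Finite A] {R : Type*} [IdemSemiring R] [Finite R]
    (G : Set (Language A)) (hG : StarFree.IsGroupPrevariety G)
    (ρ : Language A →+* R) (hρ : StarFree.Nice ρ) :
    IsLeast {S : Set R | StarFree.SFComplete G ρ S}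
      (StarFree.epsApprox G (StarFree.nested (StarFree.SF G) ρ)) :=
  ⟨StarFree.epsApprox_nested_sfComplete hG ρ,
    fun _ hS => StarFree.epsApprox_nested_subset hG hρ hS⟩
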